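/- **Setting.** Let $X,Y$ be finite sets, $\mathbf s\in\mathbb N^X$, $\mathbf t\in\mathbb N^Y$ with $\sum_{x} s_x=\sum_y t_y=:M$, and let $\Delta\ge 2$ be the largest component of $\mathbf s$ and $\mathbf t$. Put $S_k=\sum_x (s_x)_k$, $T_k=\sum_y (t_y)_k$ (falling factorials). For $\mathbf m=(m_2,\dots,m_\Delta)\in\mathbb N^{\Delta-1}$ let $S(\mathbf m)=\sum_{i=2}^\Delta i\,m_i$, let $\ell(\mathbf m)$ be the largest $k$ with $m_k>0$ ($\ell(\mathbf 0)=2$), and let $\mathcal H_{\mathbf m}$ be the set of bipartite multigraphs with parts $X,Y$, degrees $(\mathbf s,\mathbf t)$ and exactly $m_i$ pairs of vertices joined by exactly $i$ edges ($2\le i\le \Delta$); so $\mathcal H_{\mathbf 0}$ is the set of simple bipartite graphs with degrees $(\mathbf s,\mathbf t)$. **Switchings.** For $k\ge2$, a $k$-switching on $G$ is given by distinct vertices $u_1,v_1,\dots,u_{k+1},v_{k+1}$ (in this order) with $u_1\in X$, $v_1\in Y$, $u_i\in Y$, $v_i\in X$ for $2\le i\le k+1$, such that $u_1u_i$ and $v_1v_i$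 are single edges of $G$, $u_i,v_i$ are not adjacent ($2\le i\le k+1$), and $u_1,v_1$ are not adjacent. It replaces the edges $u_1u_i,v_1v_i$ by single edges $u_iv_i$ ($2\le i\le k+1$) and a $k$-fold edge $u_1v_1$. Let $f_k(G)$ be the number of $k$-switchings on $G$. For a $k$-switching $\sigma$ put $V_0(\sigma)=\emptyset$ and $V_i(\sigma)=(u_1,v_1,\dots,u_i,v_i)$. For $\sigma$ producing a multigraph $H$ and $0\le i\le k$ let $b_k(H,V_i(\sigma))$ be the number of pairs $(u,v)$ such that some $k$-switching $\sigma'$ converting some multigraph into $H$ has $V_{i+1}(\sigma')=(V_i(\sigma),u,v)$, and let $b_k(H,\sigma)=\prod_{i=0}^k b_k(H,V_i(\sigma))$. **Parameters.** Let $t_0>7$ be an integer such that, with $\epsilon=1-(t_0+4\Delta^2)/M$, $$\epsilon^3>4\Delta^4/M\quad\text{and}\quad 2t_0(t_0-\Delta^2-\Delta^3)\ge (t_0+4\Delta^2)^2 .$$ Let $\overline f_k=S_kT_k$ and $\underline b_k(\mathbf m)=\prod_{i=0}^k\underline b_k(\mathbf m,i)$, where $\underline b_k(\mathbf m,0)=m_k$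 and, for $1\le i\le k$, $\underline b_2(\mathbf m,i)=M-S(\mathbf m)-2i\Delta-2\Delta^2$ and $\underline b_k(\mathbf m,i)=\epsilon M$ if $k\ge3$. Let $\beta_{\mathbf m}=-1$ if $S(\mathbf m)\ge t_0$; if $S(\mathbf m)<t_0$ let $$\beta_{\mathbf m}=\frac{4\Delta^{2\ell-2}}{M^{\ell-2}\epsilon^{\ell}}\ \text{ when } \ell=\ell(\mathbf m)\ge3,\qquad \beta_{\mathbf m}=\sum_{i=2}^{\Delta}\frac{\overline f_i}{\underline b_i(\mathbf m+\mathbf e_i)}\,(1+\beta_{\mathbf m+\mathbf e_i})\ \text{ when } \ell(\mathbf m)=2 .$$ **Procedure Gen.** On input $G\in\mathcal H_{\mathbf 0}$ start with $\mathbf m=\mathbf 0$, $\tau=2$. While $S(\mathbf m)<t_0$: with probability $\frac1{1+\beta_{\mathbf m}}$ output $G$ and stop; otherwise choose $k\in\{\tau,\dots,\Delta\}$ with probability $\frac{\overline f_k}{\underline b_k(\mathbf m+\mathbf e_k)}\cdot\frac{1+\beta_{\mathbf m+\mathbf e_k}}{\beta_{\mathbf m}}$ each, rejecting with the remaining probability;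 choose a uniformly random $k$-switching $\sigma$ on $G$, producing $G'$ (reject if there is none); reject with probability $1-f_k(G)/\overline f_k$; then reject with probability $1-\underline b_k(\mathbf m+\mathbf e_k)/b_k(G',\sigma)$; if there was no rejection, replace $(G,\mathbf m,\tau)$ by $(G',\mathbf m+\mathbf e_k,k)$. A rejection ends the run without output. **Theorem.** Suppose that the input $G$ of Gen is uniformly distributed in $\mathcal H_{\mathbf 0}$ (in particular $\mathcal H_{\mathbf 0}\ne\emptyset$). Then Gen is well defined, that is, the probabilities it calls for lie between $0$ and $1$: for every $\mathbf m$ with $S(\mathbf m)<t_0$ one has $\beta_{\mathbf m}\ge0$, and the choice probabilities of the $k\in\{\ell(\mathbf m),\dots,\Delta\}$ are nonnegative with sum at most $1$; and, whenever $S(\mathbf m+\mathbf e_k)<t_0$, $2\le k\le\Delta$ and $G\in\mathcal H_{\mathbf m}$, both switching rejection probabilities lie in $[0,1]$, for every $k$-switching on $G$. (A quotient with denominator $0$ is read as $0$; choice and rejection probabilities involving such a quotient are never called for.) Moreover, Gen outputs every bipartite multigraph with degrees $(\mathbf s,\mathbf t)$ in which fewer than $t_0$ edges are contained in multiple edges with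 the same probability, namely $$\frac{1}{(1+\beta_{\mathbf 0})\,|\mathcal H_{\mathbf 0}|}.$$ -/

import Mathlib

namespace BipartiteGen

open scoped ENNReal

noncomputable section

universe v w

variable {X : Type v} {Y : Type w} [Fintype X] [Fintype Y]

/-! ### Bipartite multigraphs with given degrees and their strata -/

/-- A bipartite multigraph with parts `X` and `Y`, as its matrix of edge multiplicities. -/
abbrev Multigraph (X : Type v) (Y : Type w) : Type (max v w) := X → Y → ℕ

/-- The bipartite multigraphs with bipartite degree sequence `(s, t)`. -/
def multigraphs (s : X → ℕ) (t : Y → ℕ) : Set (Multigraph X Y) :=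
  {G | (∀ x, ∑ y, G x y = s x) ∧ ∀ y, ∑ x, G x y = t y}

/-- The maximum degree `Δ`. -/
def maxDeg (s : X → ℕ) (t : Y → ℕ) : ℕ :=
  max (Finset.univ.sup s) (Finset.univ.sup t)

/-- The number of edges `M`. -/
def numEdges (s : X → ℕ) : ℕ := ∑ x, s x

/-- The `k`-th factorial moment `∑ (s x)_k` of a degree sequence (`S_k` for `s`, `T_k` for `t`). -/
def moment {V : Type*} [Fintype V] (k : ℕ) (s : V → ℕ) : ℕ := ∑ x, (s x).descFactorial k

/-- A stratum index `(m_2, …, m_Δ)`. It is stored as a function on `ℕ`, of which only the values at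
`2, …, Δ` are ever used. -/
abbrev Index : Type := ℕ → ℕ

/-- The unit vector `e_k`. -/
def unitIndex (k : ℕ) : Index := Pi.single k 1

/-- `S(m) = ∑_{i=2}^Δ i m_i`. -/
def totalMult (Δ : ℕ) (m : Index) : ℕ := ∑ i ∈ Finset.Icc 2 Δ, i * m i

/-- `ℓ(m)`: the greatest `k` in `{2, …, Δ}` with `m_k > 0`, and `2` if there is none. -/
def topIndex (Δ : ℕ) (m : Index) : ℕ :=
  max 2 (((Finset.Icc 2 Δ).filter fun k => 0 < m k).sup id)

/-- The stratum index of a multigraph: the number of pairs joined by exactly `i` edges, `i ≥ 2`. -/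
def indexOf (G : Multigraph X Y) : Index := fun i =>
  if 2 ≤ i then ((Finset.univ : Finset (X × Y)).filter fun p => G p.1 p.2 = i).card else 0

/-- The stratum `H_m`. In particular `H_0` consists of the simple bipartite graphs with degrees
`(s, t)`. -/
def stratum (s : X → ℕ) (t : Y → ℕ) (m : Index) : Set (Multigraph X Y) :=
  {G | G ∈ multigraphs s t ∧ ∀ i ∈ Finset.Icc 2 (maxDeg s t), indexOf G i = m i}

/-! ### Switchings -/

/-- The vertices `((u₁, v₁), (u₂, v₂), …, (u_{k+1}, v_{k+1}))` of a `k`-switching, with `u₁ ∈ X`,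
`v₁ ∈ Y`, and `u_i ∈ Y`, `v_i ∈ X` for `i ≥ 2`. The pair `(u_i, v_i)`, `i ≥ 2`, is stored at
position `i - 2` of `Fin k`. -/
abbrev Switching (X : Type v) (Y : Type w) (k : ℕ) : Type (max v w) :=
  (X × Y) × (Fin k → Y × X)

/-- The `k`-switching `S` can be performed on `G`. The pair `u₁v₁` must not be joined in `G`, so
that the switching creates a multiple edge of multiplicity exactly `k`. -/
structure CanPerform {k : ℕ} (G : Multigraph X Y) (S : Switching X Y k) : Prop where
  u_injective : Function.Injective fun i => (S.2 i).1
  v_injective : Function.Injective fun i => (S.2 i).2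
  u_ne : ∀ i, (S.2 i).1 ≠ S.1.2
  v_ne : ∀ i, (S.2 i).2 ≠ S.1.1
  single_u : ∀ i, G S.1.1 (S.2 i).1 = 1
  single_v : ∀ i, G (S.2 i).2 S.1.2 = 1
  not_adj : ∀ i, G (S.2 i).2 (S.2 i).1 = 0
  not_adj_one : G S.1.1 S.1.2 = 0

open Classical in
/-- The multigraph obtained from `G` by the `k`-switching `S`: the single edges `u₁u_i` and `v₁v_i`
are replaced by single edges `u_iv_i` and a multiple edge `u₁v₁` of multiplicity `k`. -/
def perform {k : ℕ} (G : Multigraph X Y) (S : Switching X Y k) : Multigraph X Y := fun x y =>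
  if x = S.1.1 ∧ y = S.1.2 then k
  else if ∃ i, x = (S.2 i).2 ∧ y = (S.2 i).1 then 1
  else if ∃ i, (x = S.1.1 ∧ y = (S.2 i).1) ∨ (x = (S.2 i).2 ∧ y = S.1.2) then 0
  else G x y

/-- The `k`-switching `S` converts some multigraph to `H`. -/
def Produces {k : ℕ} (S : Switching X Y k) (H : Multigraph X Y) : Prop :=
  ∃ G : Multigraph X Y, CanPerform G S ∧ perform G S = H

open Classical in
/-- The `k`-switchings that can be performed on `G`. -/
def switchings (k : ℕ) (G : Multigraph X Y) : Finset (Switching X Y k) :=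
  Finset.univ.filter fun S => CanPerform G S

/-- `f_k(G)`. -/
def fCount (k : ℕ) (G : Multigraph X Y) : ℕ := (switchings k G).card

open Classical in
/-- `b_k(H, V_0)`: the number of valid 1-subsets `(u₁, v₁)` in `H`. -/
def bZero (k : ℕ) (H : Multigraph X Y) : ℕ :=
  ((Finset.univ : Finset (X × Y)).filter fun p =>
    ∃ S' : Switching X Y k, Produces S' H ∧ S'.1 = p).card

open Classical in
/-- `b_k(H, V_{j+1}(S))` for `j = 0, …, k - 1`: the number of ordered edges `(u, v)` that are
switching compatible with `V_{j+1}(S)`, that is, for which some `k`-switching `S'` that converts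
some multigraph to `H` satisfies `V_{j+2}(S') = V_{j+1}(S) + (u, v)`. Such a `(u, v)` is
automatically a single edge of `H`. -/
def bSucc {k : ℕ} (H : Multigraph X Y) (S : Switching X Y k) (j : Fin k) : ℕ :=
  ((Finset.univ : Finset (Y × X)).filter fun p =>
    ∃ S' : Switching X Y k, Produces S' H ∧ S'.1 = S.1 ∧
      (∀ i, i < j → S'.2 i = S.2 i) ∧ S'.2 j = p).card

/-- `b_k(H, S) = ∏_{i=0}^k b_k(H, V_i(S))`. -/
def bCount {k : ℕ} (H : Multigraph X Y) (S : Switching X Y k) : ℕ :=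
  bZero k H * ∏ j : Fin k, bSucc H S j

/-! ### Parameters -/

/-- `ε = 1 - (t₀ + 4Δ²) / M`. -/
def eps (s : X → ℕ) (t : Y → ℕ) (t₀ : ℕ) : ℝ :=
  1 - ((t₀ : ℝ) + 4 * (maxDeg s t : ℝ) ^ 2) / (numEdges s : ℝ)

/-- The conditions under which `t₀ > 0` may be chosen as the threshold. -/
structure IsThreshold (s : X → ℕ) (t : Y → ℕ) (t₀ : ℕ) : Prop where
  gt_seven : 7 < t₀
  eps_cube : 4 * (maxDeg s t : ℝ) ^ 4 / (numEdges s : ℝ) < eps s t t₀ ^ 3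
  quadratic : ((t₀ : ℝ) + 4 * (maxDeg s t : ℝ) ^ 2) ^ 2 ≤
    2 * (t₀ : ℝ) * ((t₀ : ℝ) - (maxDeg s t : ℝ) ^ 2 - (maxDeg s t : ℝ) ^ 3)

/-- The upper bound `f̄_k(m) = S_k T_k`. -/
def fUpper (s : X → ℕ) (t : Y → ℕ) (k : ℕ) : ℝ := (moment k s : ℝ) * (moment k t : ℝ)

/-- The lower bounds `b̲_k(m, i)`, `0 ≤ i ≤ k`. -/
def bLowerAt (s : X → ℕ) (t : Y → ℕ) (t₀ k : ℕ) (m : Index) (i : ℕ) : ℝ :=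
  if i = 0 then (m k : ℝ)
  else if k = 2 then
    (numEdges s : ℝ) * (1 - ((totalMult (maxDeg s t) m : ℝ) + 2 * (i : ℝ) * (maxDeg s t : ℝ)
      + 2 * (maxDeg s t : ℝ) ^ 2) / (numEdges s : ℝ))
  else eps s t t₀ * (numEdges s : ℝ)

/-- `b̲_k(m) = ∏_{i=0}^k b̲_k(m, i)`. -/
def bLower (s : X → ℕ) (t : Y → ℕ) (t₀ k : ℕ) (m : Index) : ℝ :=
  ∏ i ∈ Finset.range (k + 1), bLowerAt s t t₀ k m i

theorem totalMult_add_unitIndex {Δ k : ℕ} (hk : k ∈ Finset.Icc 2 Δ) (m : Index) :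
    totalMult Δ (m + unitIndex k) = totalMult Δ m + k := by
  simp only [totalMult, unitIndex, Pi.add_apply, mul_add, Finset.sum_add_distrib]
  congr 1
  rw [Finset.sum_eq_single k]
  · simp
  · intro b _ hb
    simp [hb]
  · intro h
    exact absurd hk h

/-- The parameters `β_m`. The sum in the last case runs over `2 ≤ i ≤ Δ`. -/
def beta (s : X → ℕ) (t : Y → ℕ) (t₀ : ℕ) (m : Index) : ℝ :=
  if t₀ ≤ totalMult (maxDeg s t) m then -1
  else if 3 ≤ topIndex (maxDeg s t) m then
    4 * (maxDeg s t : ℝ) ^ (2 * topIndex (maxDeg s t) m - 2) /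
      ((numEdges s : ℝ) ^ (topIndex (maxDeg s t) m - 2) * eps s t t₀ ^ topIndex (maxDeg s t) m)
  else ∑ i : {i // i ∈ Finset.Icc 2 (maxDeg s t)},
    fUpper s t i.1 / bLower s t t₀ i.1 (m + unitIndex i.1) * (1 + beta s t t₀ (m + unitIndex i.1))
termination_by t₀ - totalMult (maxDeg s t) m
decreasing_by
  rw [totalMult_add_unitIndex i.2]
  have := (Finset.mem_Icc.1 i.2).1
  omega

/-- The probability with which `k` is chosen in the stratum index chain at `m`. -/
def chooseProb (s : X → ℕ) (t : Y → ℕ) (t₀ : ℕ) (m : Index) (k : ℕ) : ℝ :=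
  fUpper s t k / bLower s t t₀ k (m + unitIndex k) *
    ((1 + beta s t t₀ (m + unitIndex k)) / beta s t t₀ m)

/-! ### Procedure Gen -/

/-- A coin that shows `true` with probability `p` (truncated to `[0, 1]`). -/
def coin (p : ℝ) : PMF Bool :=
  PMF.ofFintype (fun b => bif b then min (ENNReal.ofReal p) 1 else 1 - min (ENNReal.ofReal p) 1)
    (by simp)

open Classical in
/-- Choose `k ∈ A` with probability `p k`, and nothing with the remaining probability. (If this is
meaningless since the `p k` add up to more than `1`, nothing is chosen.) -/
def chooseOrReject (A : Finset ℕ) (p : ℕ → ℝ) : PMF (Option ℕ) :=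
  if h : ∑ k ∈ A, ENNReal.ofReal (p k) ≤ 1 then
    PMF.ofFinset
      (fun o => o.elim (1 - ∑ k ∈ A, ENNReal.ofReal (p k))
        fun k => if k ∈ A then ENNReal.ofReal (p k) else 0)
      (Finset.insertNone A)
      (by
        rw [Finset.sum_insertNone]
        simp only [Option.elim_none, Option.elim_some]
        rw [Finset.sum_congr rfl fun k hk => if_pos hk]
        exact tsub_add_cancel_of_le h)
      (by
        intro o ho
        cases o with
        | none => simp at ho
        | some k =>
          have hk : k ∉ A := by simpa using ho
          simp [hk])
  else PMF.pure none

/-- The states of Gen: `running m τ G` is the beginning of an iteration of the loop with current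
stratum index `m`, least remaining multiplicity `τ` and multigraph `G`; the other two are terminal
(`output G`, and restart after a rejection). -/
inductive State (X : Type v) (Y : Type w) : Type (max v w)
  | running (m : Index) (τ : ℕ) (G : Multigraph X Y)
  | output (G : Multigraph X Y)
  | rejected

open Classical in
/-- The switching part of an iteration, after `k` has been chosen: a uniformly random
`k`-switching on `G`, followed by f-rejection and b-rejection. If no `k`-switching can be performed,
the f-rejection has probability one. -/
def switchStep (s : X → ℕ) (t : Y → ℕ) (t₀ : ℕ) (m : Index) (k : ℕ) (G : Multigraph X Y) :
    PMF (State X Y) :=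
  if h : (switchings k G).Nonempty then
    (PMF.uniformOfFinset (switchings k G) h).bind fun S =>
    (coin (1 - (fCount k G : ℝ) / fUpper s t k)).bind fun fRej =>
    if fRej then PMF.pure State.rejected else
    (coin (1 - bLower s t t₀ k (m + unitIndex k) / (bCount (perform G S) S : ℝ))).bind fun bRej =>
    if bRej then PMF.pure State.rejected else
    PMF.pure (State.running (m + unitIndex k) k (perform G S))
  else PMF.pure State.rejected

/-- One iteration of the loop of Gen. Terminal states are absorbing, and so is a state in which the
loop condition `S(m) < t₀` fails (the loop is left and nothing is output). -/
def step (s : X → ℕ) (t : Y → ℕ) (t₀ : ℕ) : State X Y → PMF (State X Y)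
  | State.running m τ G =>
    if totalMult (maxDeg s t) m < t₀ then
      (coin (1 / (1 + beta s t t₀ m))).bind fun out =>
      if out then PMF.pure (State.output G) else
      (chooseOrReject (Finset.Icc τ (maxDeg s t)) (chooseProb s t t₀ m)).bind fun o =>
      match o with
      | none => PMF.pure State.rejected
      | some k => switchStep s t t₀ m k G
    else PMF.pure (State.running m τ G)
  | State.output G => PMF.pure (State.output G)
  | State.rejected => PMF.pure State.rejected

/-- The law of the state of Gen after `n` iterations, when the input multigraph has law `μ`. -/
def stateLaw (s : X → ℕ) (t : Y → ℕ) (t₀ : ℕ) (μ : PMF (Multigraph X Y)) : ℕ → PMF (State X Y)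
  | 0 => μ.map (State.running 0 2)
  | n + 1 => (stateLaw s t t₀ μ n).bind (step s t t₀)

/-- The probability that Gen outputs `H`, when its input has law `μ`: the limit (supremum, as
`output H` is absorbing) of the probabilities of having output `H` within `n` iterations. -/
def outputProb (s : X → ℕ) (t : Y → ℕ) (t₀ : ℕ) (μ : PMF (Multigraph X Y))
    (H : Multigraph X Y) : ℝ≥0∞ :=
  ⨆ n, stateLaw s t t₀ μ n (State.output H)

open Classical in
/-- `μ` is the uniform distribution on the set `A` (which is then finite and nonempty). -/
def IsUniformOn {α : Type*} (μ : PMF α) (A : Set α) : Prop :=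
  ∀ a, μ a = if a ∈ A then (A.ncard : ℝ≥0∞)⁻¹ else 0

/-- Gen is well defined: all the probabilities that it calls for are between `0` and `1`. -/
structure WellDefined (s : X → ℕ) (t : Y → ℕ) (t₀ : ℕ) : Prop where
  output_prob : ∀ m, totalMult (maxDeg s t) m < t₀ →
    0 ≤ beta s t t₀ m ∧ 1 / (1 + beta s t t₀ m) ∈ Set.Icc (0 : ℝ) 1
  choose_nonneg : ∀ m, totalMult (maxDeg s t) m < t₀ →
    ∀ k ∈ Finset.Icc (topIndex (maxDeg s t) m) (maxDeg s t), 0 ≤ chooseProb s t t₀ m k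
  choose_sum_le : ∀ m, totalMult (maxDeg s t) m < t₀ →
    ∑ k ∈ Finset.Icc (topIndex (maxDeg s t) m) (maxDeg s t), chooseProb s t t₀ m k ≤ 1
  f_prob : ∀ m k, k ∈ Finset.Icc 2 (maxDeg s t) →
    totalMult (maxDeg s t) (m + unitIndex k) < t₀ → ∀ G ∈ stratum s t m,
    1 - (fCount k G : ℝ) / fUpper s t k ∈ Set.Icc (0 : ℝ) 1
  b_prob : ∀ m k, k ∈ Finset.Icc 2 (maxDeg s t) →
    totalMult (maxDeg s t) (m + unitIndex k) < t₀ → ∀ G ∈ stratum s t m, ∀ S ∈ switchings k G,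
    1 - bLower s t t₀ k (m + unitIndex k) / (bCount (perform G S) S : ℝ) ∈ Set.Icc (0 : ℝ) 1

end

end BipartiteGen

/-! Gen is a Markov chain whose law can be written down exactly. Put N = (1+β_0)|H_0|. The invariant
is that every multigraph G with degrees (s, t), index m and S(m) < t₀ is visited with probability
(1+β_m)/N, a value depending only on its stratum (`stateLaw_running`). A visit ends in output with
probability 1/(1+β_m), so each such G is output with probability 1/N (`stateLaw_output`).

Multiplicities are created in nondecreasing order, so the last k is the largest multiplicity ℓ(m).
Hence the preceding index m₀ = m − e_k is unique, and G can be visited only after exactly as many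
iterations as it has multiple edges. A visited G' in the stratum of m₀ moves on to H by the
switching σ with probability β/(1+β) · (f̄/b̲)(1+β_m)/β · (1/f(G'))(f(G')/f̄)(b̲/b(H,σ)), where β =
β_{m₀}. Multiplied by (1+β)/N this is ((1+β_m)/N) / b(H,σ). The invariant propagates because the
numbers 1/b(H,σ), over all σ producing H, add up to 1 (`sum_inv_bCount_eq_one`): they are the
probabilities of the outcomes when σ is built pair by pair, each pair uniform among those that can
still be completed.

That all probabilities lie in [0, 1] rests on three estimates. Counting injective sequences of
neighbours gives f_k ≤ S_k T_k (`fCount_le`). Since M > t₀ + 4Δ², partially chosen undoings always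
extend greedily, which gives b̲ ≤ b (`bLower_le_bCount`). The bounds on f̄_k/b̲_k for k ≥ 3 decay at
least like 16^{-k}, so that the chosen β dominates the sum of the choice weights
(`sum_chooseProb_le`). -/

namespace BipartiteGen

open scoped ENNReal

noncomputable section

universe v w

variable {X : Type v} {Y : Type w} [Fintype X] [Fintype Y]

/-! ### Undoing switchings -/

/-- The first `j` of the pairs `(u_i, v_i)`, `i ≥ 2`, of `S` satisfy what is needed to undo `S`
on `H`. For `j = k` this says that `S` can be undone. -/
structure UndoableUpTo {k : ℕ} (H : Multigraph X Y) (S : Switching X Y k) (j : ℕ) : Prop where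
  mult : H S.1.1 S.1.2 = k
  single : ∀ i : Fin k, i.val < j → H (S.2 i).2 (S.2 i).1 = 1
  not_adj_u : ∀ i : Fin k, i.val < j → H S.1.1 (S.2 i).1 = 0
  not_adj_v : ∀ i : Fin k, i.val < j → H (S.2 i).2 S.1.2 = 0
  u_ne : ∀ i i' : Fin k, i < i' → i'.val < j → (S.2 i).1 ≠ (S.2 i').1
  v_ne : ∀ i i' : Fin k, i < i' → i'.val < j → (S.2 i).2 ≠ (S.2 i').2

open Classical in
/-- The multigraph on which `S` produces `H`. -/
def undo {k : ℕ} (H : Multigraph X Y) (S : Switching X Y k) : Multigraph X Y := fun x y =>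
  if x = S.1.1 ∧ y = S.1.2 then 0
  else if ∃ i, x = (S.2 i).2 ∧ y = (S.2 i).1 then 0
  else if ∃ i, (x = S.1.1 ∧ y = (S.2 i).1) ∨ (x = (S.2 i).2 ∧ y = S.1.2) then 1
  else H x y

omit [Fintype X] [Fintype Y] in
theorem UndoableUpTo.of_perform {k : ℕ} {G : Multigraph X Y} {S : Switching X Y k}
    (h : CanPerform G S) : UndoableUpTo (perform G S) S k where
  mult := by simp [perform]
  single i _ := by
    have : (S.2 i).2 ≠ S.1.1 := h.v_ne i
    have h2 : ∃ i', (S.2 i).2 = (S.2 i').2 ∧ (S.2 i).1 = (S.2 i').1 := ⟨i, rfl, rfl⟩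
    simp only [perform, this, false_and, if_false, h2, if_true]
  not_adj_u i _ := by
    have h1 := h.u_ne i
    have h2 : ¬ ∃ i', S.1.1 = (S.2 i').2 ∧ (S.2 i).1 = (S.2 i').1 := by
      rintro ⟨i', h3, _⟩
      exact h.v_ne i' h3.symm
    have h4 : ∃ i', (S.1.1 = S.1.1 ∧ (S.2 i).1 = (S.2 i').1) ∨
      (S.1.1 = (S.2 i').2 ∧ (S.2 i).1 = S.1.2) := ⟨i, Or.inl ⟨rfl, rfl⟩⟩
    simp only [perform, h1, and_false, if_false, h2]
    rw [if_pos (by simpa [h1] using h4)]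
  not_adj_v i _ := by
    have h1 := h.v_ne i
    have h2 : ¬ ∃ i', (S.2 i).2 = (S.2 i').2 ∧ S.1.2 = (S.2 i').1 := by
      rintro ⟨i', _, h3⟩
      exact h.u_ne i' h3.symm
    simp only [perform, h1, false_and, if_false, h2]
    rw [if_pos ⟨i, Or.inr ⟨rfl, rfl⟩⟩]
  u_ne i i' hi _ h' := hi.ne (h.u_injective h')
  v_ne i i' hi _ h' := hi.ne (h.v_injective h')

omit [Fintype X] [Fintype Y] in
theorem undo_perform {k : ℕ} {G : Multigraph X Y} {S : Switching X Y k}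
    (h : CanPerform G S) : undo (perform G S) S = G := by
  funext x y
  unfold undo
  split_ifs with h1 h2 h3
  · rw [h1.1, h1.2, h.not_adj_one]
  · obtain ⟨i, rfl, rfl⟩ := h2
    exact (h.not_adj i).symm
  · obtain ⟨i, ⟨rfl, rfl⟩ | ⟨rfl, rfl⟩⟩ := h3
    · exact (h.single_u i).symm
    · exact (h.single_v i).symm
  · simp only [perform, h1, h2, h3, if_false]

omit [Fintype X] [Fintype Y] in
theorem UndoableUpTo.canPerform {k : ℕ} (hk : 2 ≤ k) {H : Multigraph X Y} {S : Switching X Y k}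
    (h : UndoableUpTo H S k) : CanPerform (undo H S) S := by
  -- Distinctness from `u₁` and `v₁` need not be part of `UndoableUpTo`: a coincidence would give
  -- the pair `u₁v₁` multiplicity both `k` and 0.
  have une : ∀ i, (S.2 i).1 ≠ S.1.2 := fun i h' => by
    have := h.not_adj_u i i.2
    rw [h', h.mult] at this
    omega
  have vne : ∀ i, (S.2 i).2 ≠ S.1.1 := fun i h' => by
    have := h.not_adj_v i i.2
    rw [h', h.mult] at this
    omega
  refine ⟨fun i i' hi => ?_, fun i i' hi => ?_, une, vne, fun i => ?_, fun i => ?_, fun i => ?_, ?_⟩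
  · by_contra hne
    rcases lt_or_gt_of_ne hne with h1 | h1
    · exact h.u_ne i i' h1 i'.2 hi
    · exact h.u_ne i' i h1 i.2 hi.symm
  · by_contra hne
    rcases lt_or_gt_of_ne hne with h1 | h1
    · exact h.v_ne i i' h1 i'.2 hi
    · exact h.v_ne i' i h1 i.2 hi.symm
  · have h2 : ¬ ∃ i', S.1.1 = (S.2 i').2 ∧ (S.2 i).1 = (S.2 i').1 := by
      rintro ⟨i', h3, _⟩
      exact vne i' h3.symm
    simp only [undo]
    rw [if_neg (by simp [une i]), if_neg h2, if_pos ⟨i, Or.inl ⟨rfl, rfl⟩⟩]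
  · have h2 : ¬ ∃ i', (S.2 i).2 = (S.2 i').2 ∧ S.1.2 = (S.2 i').1 := by
      rintro ⟨i', _, h3⟩
      exact une i' h3.symm
    simp only [undo]
    rw [if_neg (by simp [vne i]), if_neg h2, if_pos ⟨i, Or.inr ⟨rfl, rfl⟩⟩]
  · simp only [undo]
    rw [if_neg (by simp [vne i]), if_pos ⟨i, rfl, rfl⟩]
  · simp [undo]

omit [Fintype X] [Fintype Y] in
theorem UndoableUpTo.perform_undo {k : ℕ} {H : Multigraph X Y} {S : Switching X Y k}
    (h : UndoableUpTo H S k) : perform (undo H S) S = H := by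
  funext x y
  unfold perform
  split_ifs with h1 h2 h3
  · rw [h1.1, h1.2, h.mult]
  · obtain ⟨i, rfl, rfl⟩ := h2
    exact (h.single i i.2).symm
  · obtain ⟨i, ⟨rfl, rfl⟩ | ⟨rfl, rfl⟩⟩ := h3
    · exact (h.not_adj_u i i.2).symm
    · exact (h.not_adj_v i i.2).symm
  · simp only [undo, h1, h2, h3, if_false]

-- Eliminates the unknown predecessor: producing `H` becomes a condition on `H` and the pairs of `S`
-- alone, which can be tested one pair at a time.
omit [Fintype X] [Fintype Y] in
theorem produces_iff {k : ℕ} (hk : 2 ≤ k) {H : Multigraph X Y} {S : Switching X Y k} :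
    Produces S H ↔ UndoableUpTo H S k := by
  constructor
  · rintro ⟨G, hG, rfl⟩
    exact .of_perform hG
  · exact fun h => ⟨undo H S, h.canPerform hk, h.perform_undo⟩

-- The target and the switching determine the predecessor, so sums over predecessors and their
-- switchings become sums over switchings producing `H`.
omit [Fintype X] [Fintype Y] in
theorem canPerform_and_perform_eq_iff {k : ℕ} (hk : 2 ≤ k) {G H : Multigraph X Y}
    {S : Switching X Y k} :
    (CanPerform G S ∧ perform G S = H) ↔ Produces S H ∧ G = undo H S := by
  rw [produces_iff hk]
  constructor
  · rintro ⟨hG, rfl⟩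
    exact ⟨.of_perform hG, (undo_perform hG).symm⟩
  · rintro ⟨h, rfl⟩
    exact ⟨h.canPerform hk, h.perform_undo⟩

/-! ### Degrees and strata under a switching -/

-- The balance of removed and added edges, with both sides additive to avoid truncated subtraction.
-- The indicators are nested so that summing over a row or a column collapses them.
open Classical in
omit [Fintype X] [Fintype Y] in
theorem perform_add {k : ℕ} {G : Multigraph X Y} {S : Switching X Y k}
    (h : CanPerform G S) (x : X) (y : Y) :
    perform G S x y + ∑ i, ((if x = S.1.1 then if y = (S.2 i).1 then 1 else 0 else 0) +
      (if x = (S.2 i).2 then if y = S.1.2 then 1 else 0 else 0)) =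
    G x y + (if x = S.1.1 then if y = S.1.2 then k else 0 else 0) +
      ∑ i, (if x = (S.2 i).2 then if y = (S.2 i).1 then 1 else 0 else 0) := by
  have hv : ∀ i, S.1.1 ≠ (S.2 i).2 := fun i => (h.v_ne i).symm
  have hu : ∀ i, S.1.2 ≠ (S.2 i).1 := fun i => (h.u_ne i).symm
  have hvi : ∀ i j, (S.2 i).2 = (S.2 j).2 ↔ i = j := fun i j => h.v_injective.eq_iff
  have hui : ∀ i j, (S.2 i).1 = (S.2 j).1 ↔ i = j := fun i j => h.u_injective.eq_iff
  by_cases h1 : x = S.1.1 ∧ y = S.1.2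
  · obtain ⟨rfl, rfl⟩ := h1
    simp [perform, hv, hu, h.not_adj_one]
  by_cases h2 : ∃ i, x = (S.2 i).2 ∧ y = (S.2 i).1
  · obtain ⟨i, rfl, rfl⟩ := h2
    have e1 := (UndoableUpTo.of_perform h).single i i.2
    rw [e1, h.not_adj i]
    simp [h.v_ne i, h.u_ne i, hvi, hui]
  by_cases h3 : ∃ i, (x = S.1.1 ∧ y = (S.2 i).1) ∨ (x = (S.2 i).2 ∧ y = S.1.2)
  · obtain ⟨i, ⟨rfl, rfl⟩ | ⟨rfl, rfl⟩⟩ := h3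
    · rw [(UndoableUpTo.of_perform h).not_adj_u i i.2, h.single_u i]
      simp [hv, h.u_ne i, hui]
    · rw [(UndoableUpTo.of_perform h).not_adj_v i i.2, h.single_v i]
      simp [hu, h.v_ne i, hvi]
  · have e : perform G S x y = G x y := by simp only [perform, h1, h2, h3, if_false]
    rw [e]
    push Not at h1 h2 h3
    have z1 : ∀ i, (if x = S.1.1 then if y = (S.2 i).1 then 1 else 0 else 0) +
      (if x = (S.2 i).2 then if y = S.1.2 then 1 else 0 else 0) = 0 := by
      intro i
      have := h3 i
      split_ifs <;> simp_all
    have z2 : ∀ i, (if x = (S.2 i).2 then if y = (S.2 i).1 then 1 else 0 else 0) = 0 := by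
      intro i
      have := h2 i
      split_ifs <;> simp_all
    have z3 : (if x = S.1.1 then if y = S.1.2 then k else 0 else 0) = 0 := by
      split_ifs <;> simp_all
    simp [z1, z2, z3]

theorem perform_mem_multigraphs_iff {k : ℕ} {s : X → ℕ} {t : Y → ℕ} {G : Multigraph X Y}
    {S : Switching X Y k} (h : CanPerform G S) :
    perform G S ∈ multigraphs s t ↔ G ∈ multigraphs s t := by
  classical
  have hx : ∀ x, ∑ y, perform G S x y = ∑ y, G x y := by
    intro x
    have := Finset.sum_congr rfl fun y (_ : y ∈ Finset.univ) => perform_add h x y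
    simp only [Finset.sum_add_distrib] at this
    rw [Finset.sum_comm, Finset.sum_comm (f := fun y i => if x = (S.2 i).2 then
      if y = S.1.2 then 1 else 0 else 0), Finset.sum_comm (f := fun y i => if x = (S.2 i).2 then
      if y = (S.2 i).1 then 1 else 0 else 0)] at this
    -- At `u₁` the `k` lost single edges are balanced by the `k`-fold edge; at each `v_i` one edge
    -- is lost and one gained.
    by_cases hx : x = S.1.1 <;> simp [hx] at this ⊢ <;> omega
  have hy : ∀ y, ∑ x, perform G S x y = ∑ x, G x y := by
    intro y
    have := Finset.sum_congr rfl fun x (_ : x ∈ Finset.univ) => perform_add h x y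
    simp only [Finset.sum_add_distrib] at this
    rw [Finset.sum_comm, Finset.sum_comm (f := fun x i => if x = (S.2 i).2 then
      if y = S.1.2 then 1 else 0 else 0), Finset.sum_comm (f := fun x i => if x = (S.2 i).2 then
      if y = (S.2 i).1 then 1 else 0 else 0)] at this
    by_cases hx : y = S.1.2 <;> simp [hx] at this ⊢ <;> omega
  simp only [multigraphs, Set.mem_ofPred_eq, hx, hy]

/-- Apart from `u₁v₁`, every pair touched has multiplicity 0 or 1 both before and after. Equality
holds on all of ℕ, so that the predecessor's index can later be found by cancellation. -/
theorem indexOf_perform {k : ℕ} (hk : 2 ≤ k) {G : Multigraph X Y}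
    {S : Switching X Y k} (h : CanPerform G S) :
    indexOf (perform G S) = indexOf G + unitIndex k := by
  classical
  have key : ∀ i, 2 ≤ i → ∀ p : X × Y, perform G S p.1 p.2 = i ↔
      (G p.1 p.2 = i ∨ (i = k ∧ p = S.1)) := by
    rintro i hi ⟨x, y⟩
    have hU := UndoableUpTo.of_perform h
    have e := undo_perform h
    simp only [Prod.ext_iff]
    by_cases h1 : x = S.1.1 ∧ y = S.1.2
    · obtain ⟨rfl, rfl⟩ := h1
      rw [hU.mult, h.not_adj_one]
      simp only [and_self, and_true]
      omega
    simp only [h1, and_false, or_false]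
    simp only [perform, h1, if_false]
    split_ifs with h2 h3
    · obtain ⟨j, rfl, rfl⟩ := h2
      rw [h.not_adj]
      omega
    · obtain ⟨j, ⟨rfl, rfl⟩ | ⟨rfl, rfl⟩⟩ := h3
      · rw [h.single_u]
        omega
      · rw [h.single_v]
        omega
    · rfl
  funext i
  simp only [indexOf, unitIndex, Pi.add_apply]
  split_ifs with hi
  · simp only [key i hi]
    by_cases hik : i = k
    · subst hik
      have : (Finset.univ.filter fun p : X × Y => G p.1 p.2 = i ∨ (i = i ∧ p = S.1)) =
          insert S.1 (Finset.univ.filter fun p : X × Y => G p.1 p.2 = i) := by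
        ext p
        simp [or_comm]
      rw [this, Finset.card_insert_of_notMem, Pi.single_eq_same]
      simp [h.not_adj_one]
      omega
    · simp [hik]
  · have : i ≠ k := by omega
    simp [this]

/-! ### Multiplicities -/

theorem le_maxDeg_left (s : X → ℕ) (t : Y → ℕ) (x : X) : s x ≤ maxDeg s t :=
  (Finset.le_sup (f := s) (Finset.mem_univ x)).trans (le_max_left _ _)

theorem le_maxDeg_right (s : X → ℕ) (t : Y → ℕ) (y : Y) : t y ≤ maxDeg s t :=
  (Finset.le_sup (f := t) (Finset.mem_univ y)).trans (le_max_right _ _)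

theorem apply_le_maxDeg {s : X → ℕ} {t : Y → ℕ} {G : Multigraph X Y} (hG : G ∈ multigraphs s t)
    (x : X) (y : Y) : G x y ≤ maxDeg s t := by
  refine le_trans ?_ (le_maxDeg_left s t x)
  rw [← hG.1 x]
  exact Finset.single_le_sum (f := fun y => G x y) (fun _ _ => Nat.zero_le _) (Finset.mem_univ y)

theorem indexOf_eq_zero {s : X → ℕ} {t : Y → ℕ} {G : Multigraph X Y} (hG : G ∈ multigraphs s t)
    {i : ℕ} (hi : i ∉ Finset.Icc 2 (maxDeg s t)) : indexOf G i = 0 := by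
  simp only [Finset.mem_Icc, not_and, not_le] at hi
  unfold indexOf
  split_ifs with h
  · rw [Finset.card_eq_zero, Finset.filter_eq_empty_iff]
    intro p _ hp
    have := apply_le_maxDeg hG p.1 p.2
    have := hi h
    omega
  · rfl

theorem card_single_add_totalMult {s : X → ℕ} {t : Y → ℕ} {G : Multigraph X Y}
    (hG : G ∈ multigraphs s t) (hΔ : 2 ≤ maxDeg s t) :
    (Finset.univ.filter fun p : X × Y => G p.1 p.2 = 1).card +
      totalMult (maxDeg s t) (indexOf G) = numEdges s := by
  have h1 : numEdges s = ∑ p : X × Y, G p.1 p.2 := by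
    rw [Fintype.sum_prod_type]
    exact Finset.sum_congr rfl fun x _ => (hG.1 x).symm
  rw [h1, ← Finset.sum_fiberwise_of_maps_to (t := Finset.range (maxDeg s t + 1))
    (g := fun p : X × Y => G p.1 p.2)
    (fun p _ => Finset.mem_range.2 (Nat.lt_succ_of_le (apply_le_maxDeg hG p.1 p.2)))]
  have h2 : ∀ i ∈ Finset.range (maxDeg s t + 1),
      ∑ p : X × Y with G p.1 p.2 = i, G p.1 p.2 =
        i * (Finset.univ.filter fun p : X × Y => G p.1 p.2 = i).card := by
    intro i _
    rw [Finset.sum_congr rfl fun p hp => (Finset.mem_filter.1 hp).2]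
    simp [mul_comm]
  rw [Finset.sum_congr rfl h2]
  have h3 : Finset.range (maxDeg s t + 1) = insert 0 (insert 1 (Finset.Icc 2 (maxDeg s t))) := by
    ext i
    simp only [Finset.mem_range, Finset.mem_insert, Finset.mem_Icc]
    omega
  rw [h3, Finset.sum_insert (by simp), Finset.sum_insert (by simp)]
  simp only [zero_mul, one_mul, zero_add, totalMult]
  congr 1
  refine Finset.sum_congr rfl fun i hi => ?_
  simp [indexOf, (Finset.mem_Icc.1 hi).1]

/-! ### Counting switchings -/

theorem card_injections_le {α : Type*} [Fintype α] (A : Finset α) (k n : ℕ) (h : A.card ≤ n)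
    (F : Finset (Fin k → α)) (hF : ∀ f ∈ F, Function.Injective f ∧ ∀ i, f i ∈ A) :
    F.card ≤ n.descFactorial k := by
  classical
  refine le_trans ?_ (Nat.descFactorial_le k h)
  have : Fintype.card (Fin k ↪ A) = A.card.descFactorial k := by
    rw [Fintype.card_embedding_eq]
    simp
  rw [← this, ← Finset.card_univ]
  refine Finset.card_le_card_of_surjOn (fun e i => (e i : α)) fun f hf => ?_
  obtain ⟨h1, h2⟩ := hF f hf
  exact ⟨⟨fun i => ⟨f i, h2 i⟩, fun i j hij => h1 (by simpa using hij)⟩, by simp, rfl⟩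

theorem card_filter_eq_one_le {α : Type*} [Fintype α] (f : α → ℕ) :
    (Finset.univ.filter fun a => f a = 1).card ≤ ∑ a, f a := by
  rw [Finset.card_filter]
  refine Finset.sum_le_sum fun a _ => ?_
  split_ifs with h <;> omega

/-- For fixed `(u₁, v₁)` the `u_i` form an injective sequence of single neighbours of `u₁`, and the
`v_i` one of `v₁`; the non-adjacency conditions are dropped. -/
theorem fCount_le {s : X → ℕ} {t : Y → ℕ} {G : Multigraph X Y} (hG : G ∈ multigraphs s t) (k : ℕ) :
    fCount k G ≤ moment k s * moment k t := by
  classical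
  let F : X × Y → Finset (Fin k → Y × X) := fun p =>
    Finset.univ.filter fun g => CanPerform G (p, g)
  have h1 : fCount k G = ∑ p, (F p).card := by
    rw [fCount, switchings, ← Finset.card_sigma]
    refine Finset.card_bij (fun S _ => ⟨S.1, S.2⟩) ?_ ?_ ?_
    · intro S hS
      simpa [F] using hS
    · rintro ⟨a, b⟩ _ ⟨c, d⟩ _ h
      simpa using h
    · rintro ⟨p, g⟩ h
      exact ⟨(p, g), by simpa [F] using h, rfl⟩
  rw [h1, moment, moment, Finset.sum_mul_sum, ← Finset.sum_product']
  refine Finset.sum_le_sum fun p _ => ?_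
  have hU := card_injections_le (Finset.univ.filter fun y => G p.1 y = 1) k (s p.1)
    ((card_filter_eq_one_le _).trans (hG.1 p.1).le) ((F p).image fun g i => (g i).1) (by
      intro f hf
      obtain ⟨g, hg, rfl⟩ := Finset.mem_image.1 hf
      have := (Finset.mem_filter.1 hg).2
      exact ⟨this.u_injective, fun i => by simpa using this.single_u i⟩)
  have hV := card_injections_le (Finset.univ.filter fun x => G x p.2 = 1) k (t p.2)
    ((card_filter_eq_one_le _).trans (hG.2 p.2).le) ((F p).image fun g i => (g i).2) (by
      intro f hf
      obtain ⟨g, hg, rfl⟩ := Finset.mem_image.1 hf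
      have := (Finset.mem_filter.1 hg).2
      exact ⟨this.v_injective, fun i => by simpa using this.single_v i⟩)
  refine le_trans ?_ (Nat.mul_le_mul hU hV)
  rw [← Finset.card_product]
  refine Finset.card_le_card_of_injOn (fun g => (fun i => (g i).1, fun i => (g i).2)) ?_ ?_
  · intro g hg
    exact Finset.mem_product.2 ⟨Finset.mem_image_of_mem _ hg, Finset.mem_image_of_mem _ hg⟩
  · intro g _ g' _ h
    funext i
    exact Prod.ext (congrFun (congrArg Prod.fst h) i) (congrFun (congrArg Prod.snd h) i)

theorem moment_le {V : Type*} [Fintype V] (s : V → ℕ) {D : ℕ} (hs : ∀ x, s x ≤ D) {k : ℕ}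
    (hk : 1 ≤ k) : moment k s ≤ (∑ x, s x) * D ^ (k - 1) := by
  rw [moment, Finset.sum_mul]
  refine Finset.sum_le_sum fun x _ => (Nat.descFactorial_le_pow _ _).trans ?_
  obtain ⟨k, rfl⟩ := Nat.exists_eq_add_of_le' hk
  rw [pow_succ, mul_comm, Nat.add_sub_cancel]
  exact Nat.mul_le_mul_left _ (Nat.pow_le_pow_left (hs x) k)

/-! ### Counting ways to undo a switching -/

open Classical in
/-- The edges `(u, v)` that may follow the pairs `(u_i, v_i)` of `S` with `i` among the first `j`
when undoing a switching. -/
def nextEdges {k : ℕ} (H : Multigraph X Y) (S : Switching X Y k) (j : ℕ) : Finset (Y × X) :=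
  Finset.univ.filter fun p => H p.2 p.1 = 1 ∧ H S.1.1 p.1 = 0 ∧ H p.2 S.1.2 = 0 ∧
    ∀ i : Fin k, i.val < j → (S.2 i).1 ≠ p.1 ∧ (S.2 i).2 ≠ p.2

theorem card_filter_ne_zero_le {α : Type*} [Fintype α] (f : α → ℕ) :
    (Finset.univ.filter fun a => f a ≠ 0).card ≤ ∑ a, f a := by
  rw [Finset.card_filter]
  refine Finset.sum_le_sum fun a _ => ?_
  split_ifs with h <;> omega

theorem card_filter_val_lt_le (k j : ℕ) :
    (Finset.univ.filter fun i : Fin k => i.val < j).card ≤ j := by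
  rw [← Finset.card_range j]
  refine Finset.card_le_card_of_injOn (fun i => i.val) (fun i hi => ?_)
    fun i _ i' _ h => Fin.ext h
  simpa using hi

/-- Of the M − S single edges, only those meeting a bad vertex are lost. On each side the bad
vertices are the at most Δ neighbours of `u₁` or `v₁` and the at most `j` vertices already used,
each on at most Δ single edges. -/
theorem numEdges_le_card_nextEdges {s : X → ℕ} {t : Y → ℕ} {H : Multigraph X Y}
    (hH : H ∈ multigraphs s t) (hΔ : 2 ≤ maxDeg s t) {k : ℕ} (S : Switching X Y k) (j : ℕ) :
    numEdges s ≤ (nextEdges H S j).card + totalMult (maxDeg s t) (indexOf H) +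
      2 * (maxDeg s t * (maxDeg s t + j)) := by
  classical
  let W : Finset Y := (Finset.univ.filter fun y => H S.1.1 y ≠ 0) ∪
    (Finset.univ.filter fun i : Fin k => i.val < j).image fun i => (S.2 i).1
  let Z : Finset X := (Finset.univ.filter fun x => H x S.1.2 ≠ 0) ∪
    (Finset.univ.filter fun i : Fin k => i.val < j).image fun i => (S.2 i).2
  have hW : W.card ≤ maxDeg s t + j := by
    refine (Finset.card_union_le _ _).trans (add_le_add ?_ ?_)
    · exact (card_filter_ne_zero_le _).trans ((hH.1 _).le.trans (le_maxDeg_left s t _))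
    · exact Finset.card_image_le.trans (card_filter_val_lt_le k j)
  have hZ : Z.card ≤ maxDeg s t + j := by
    refine (Finset.card_union_le _ _).trans (add_le_add ?_ ?_)
    · exact (card_filter_ne_zero_le (fun x => H x S.1.2)).trans
        ((hH.2 _).le.trans (le_maxDeg_right s t _))
    · exact Finset.card_image_le.trans (card_filter_val_lt_le k j)
  let B : Finset (X × Y) := W.biUnion fun y =>
    (Finset.univ.filter fun x => H x y = 1).image fun x => (x, y)
  let C : Finset (X × Y) := Z.biUnion fun x =>
    (Finset.univ.filter fun y => H x y = 1).image fun y => (x, y)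
  have hB : B.card ≤ maxDeg s t * (maxDeg s t + j) := by
    rw [mul_comm]
    refine (Finset.card_biUnion_le_card_mul _ _ (maxDeg s t) fun y _ => ?_).trans
      (Nat.mul_le_mul_right _ hW)
    exact Finset.card_image_le.trans ((card_filter_eq_one_le (fun x => H x y)).trans
        ((hH.2 _).le.trans (le_maxDeg_right s t _)))
  have hC : C.card ≤ maxDeg s t * (maxDeg s t + j) := by
    rw [mul_comm]
    refine (Finset.card_biUnion_le_card_mul _ _ (maxDeg s t) fun x _ => ?_).trans
      (Nat.mul_le_mul_right _ hZ)
    exact Finset.card_image_le.trans ((card_filter_eq_one_le _).trans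
        ((hH.1 _).le.trans (le_maxDeg_left s t _)))
  have hsub : (Finset.univ.filter fun p : X × Y => H p.1 p.2 = 1) ⊆
      ((nextEdges H S j).image Prod.swap ∪ B) ∪ C := by
    rintro ⟨x, y⟩ hp
    replace hp : H x y = 1 := by simpa using hp
    by_cases hy : y ∈ W
    · refine Finset.mem_union_left _ (Finset.mem_union_right _ ?_)
      exact Finset.mem_biUnion.2 ⟨y, hy, by simpa using hp⟩
    by_cases hx : x ∈ Z
    · refine Finset.mem_union_right _ ?_
      exact Finset.mem_biUnion.2 ⟨x, hx, by simpa using hp⟩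
    refine Finset.mem_union_left _ (Finset.mem_union_left _ ?_)
    refine Finset.mem_image.2 ⟨(y, x), ?_, rfl⟩
    simp only [W, Z, Finset.mem_union, Finset.mem_filter, Finset.mem_univ, true_and,
      Finset.mem_image, not_or, not_exists, not_and, not_not] at hx hy
    simp only [nextEdges, Finset.mem_filter, Finset.mem_univ, true_and]
    exact ⟨hp, hy.1, hx.1, fun i hi => ⟨hy.2 i hi, hx.2 i hi⟩⟩
  have h1 := (Finset.card_le_card hsub).trans (Finset.card_union_le _ _)
  have h2 := Finset.card_union_le ((nextEdges H S j).image Prod.swap) B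
  have h3 : ((nextEdges H S j).image Prod.swap).card ≤ (nextEdges H S j).card :=
    Finset.card_image_le
  have h4 := card_single_add_totalMult hH hΔ
  omega

omit [Fintype X] [Fintype Y] in
theorem UndoableUpTo.mono {k : ℕ} {H : Multigraph X Y} {S : Switching X Y k} {j j' : ℕ}
    (h : UndoableUpTo H S j') (hj : j ≤ j') : UndoableUpTo H S j where
  mult := h.mult
  single i hi := h.single i (hi.trans_le hj)
  not_adj_u i hi := h.not_adj_u i (hi.trans_le hj)
  not_adj_v i hi := h.not_adj_v i (hi.trans_le hj)
  u_ne i i' hi hi' := h.u_ne i i' hi (hi'.trans_le hj)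
  v_ne i i' hi hi' := h.v_ne i i' hi (hi'.trans_le hj)

theorem UndoableUpTo.update {k : ℕ} {H : Multigraph X Y} {S : Switching X Y k} (j : Fin k)
    (h : UndoableUpTo H S j) {p : Y × X} (hp : p ∈ nextEdges H S j) :
    UndoableUpTo H (S.1, Function.update S.2 j p) (j + 1) := by
  simp only [nextEdges, Finset.mem_filter, Finset.mem_univ, true_and] at hp
  obtain ⟨h1, h2, h3, h4⟩ := hp
  have aux : ∀ i : Fin k, i.val < j + 1 → i = j ∨ (i.val < j.val ∧ i ≠ j) := by
    intro i hi
    rcases Nat.lt_succ_iff_lt_or_eq.1 hi with h | h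
    · exact Or.inr ⟨h, fun h' => by simp [h'] at h⟩
    · exact Or.inl (Fin.ext h)
  refine ⟨h.mult, fun i hi => ?_, fun i hi => ?_, fun i hi => ?_, fun i i' hii hi => ?_,
    fun i i' hii hi => ?_⟩
  · rcases aux i hi with rfl | ⟨h5, h6⟩
    · simpa using h1
    · simpa [h6] using h.single i h5
  · rcases aux i hi with rfl | ⟨h5, h6⟩
    · simpa using h2
    · simpa [h6] using h.not_adj_u i h5
  · rcases aux i hi with rfl | ⟨h5, h6⟩
    · simpa using h3
    · simpa [h6] using h.not_adj_v i h5
  · rcases aux i' hi with rfl | ⟨h5, h6⟩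
    · simpa [hii.ne] using (h4 i hii).1
    · have h7 : i ≠ j := (hii.trans h5).ne
      simpa [h6, h7] using h.u_ne i i' hii h5
  · rcases aux i' hi with rfl | ⟨h5, h6⟩
    · simpa [hii.ne] using (h4 i hii).2
    · have h7 : i ≠ j := (hii.trans h5).ne
      simpa [h6, h7] using h.v_ne i i' hii h5

/-- Greedy completion: `hM` leaves an admissible edge at every stage up to `k`. A prefix is stored
as a full `Switching` whose entries from position `j` on are placeholders. -/
theorem UndoableUpTo.exists_extension {s : X → ℕ} {t : Y → ℕ} {H : Multigraph X Y}
    (hH : H ∈ multigraphs s t) (hΔ : 2 ≤ maxDeg s t) {k : ℕ}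
    (hM : totalMult (maxDeg s t) (indexOf H) + 2 * (maxDeg s t * (maxDeg s t + k)) < numEdges s)
    (d : ℕ) : ∀ (S : Switching X Y k) (j : ℕ), j + d = k → UndoableUpTo H S j →
      ∃ S' : Switching X Y k, UndoableUpTo H S' k ∧ S'.1 = S.1 ∧
        ∀ i : Fin k, i.val < j → S'.2 i = S.2 i := by
  induction d with
  | zero =>
    intro S j hj h
    obtain rfl : j = k := hj
    exact ⟨S, h, rfl, fun _ _ => rfl⟩
  | succ d ih =>
    intro S j hj h
    have hjk : j < k := by omega
    have h1 := numEdges_le_card_nextEdges hH hΔ S j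
    have h2 : 2 * (maxDeg s t * (maxDeg s t + j)) ≤ 2 * (maxDeg s t * (maxDeg s t + k)) := by
      gcongr
    obtain ⟨p, hp⟩ : (nextEdges H S j).Nonempty := by
      rw [← Finset.card_pos]
      omega
    obtain ⟨S', h3, h4, h5⟩ := ih _ (j + 1) (by omega) (h.update ⟨j, hjk⟩ hp)
    refine ⟨S', h3, h4, fun i hi => ?_⟩
    rw [h5 i (by omega)]
    have : i ≠ ⟨j, hjk⟩ := fun h => by simp [h] at hi
    simp [this]

/-- Switching compatibility asks for a completion of the whole switching; by greedy completion the
local conditions on the next edge suffice. -/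
theorem card_nextEdges_le_bSucc {s : X → ℕ} {t : Y → ℕ} {H : Multigraph X Y}
    (hH : H ∈ multigraphs s t) (hΔ : 2 ≤ maxDeg s t) {k : ℕ} (hk : 2 ≤ k)
    (hM : totalMult (maxDeg s t) (indexOf H) + 2 * (maxDeg s t * (maxDeg s t + k)) < numEdges s)
    {S : Switching X Y k} (hS : Produces S H) (j : Fin k) :
    (nextEdges H S j).card ≤ bSucc H S j := by
  refine Finset.card_le_card fun p hp => ?_
  simp only [Finset.mem_filter, Finset.mem_univ, true_and]
  have h1 := (((produces_iff hk).1 hS).mono j.2.le).update j hp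
  obtain ⟨S', h2, h3, h4⟩ := h1.exists_extension hH hΔ hM (k - (j + 1)) _ _ (by omega)
  refine ⟨S', (produces_iff hk).2 h2, h3, fun i hi => ?_, ?_⟩
  · rw [h4 i (Nat.lt_succ_of_lt hi)]
    simp [hi.ne]
  · rw [h4 j (Nat.lt_succ_self _)]
    simp

theorem indexOf_le_bZero {s : X → ℕ} {t : Y → ℕ} {H : Multigraph X Y}
    (hH : H ∈ multigraphs s t) (hΔ : 2 ≤ maxDeg s t) {k : ℕ} (hk : 2 ≤ k)
    (hM : totalMult (maxDeg s t) (indexOf H) + 2 * (maxDeg s t * (maxDeg s t + k)) < numEdges s) :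
    indexOf H k ≤ bZero k H := by
  simp only [indexOf, hk, if_true]
  refine Finset.card_le_card fun p hp => ?_
  simp only [Finset.mem_filter, Finset.mem_univ, true_and] at hp ⊢
  -- The second component is a dummy: for the empty prefix only the multiplicity of `u₁v₁` counts.
  have h1 : UndoableUpTo H ((p, fun _ => (p.2, p.1)) : Switching X Y k) 0 :=
    ⟨hp, by simp, by simp, by simp, by simp, by simp⟩
  obtain ⟨S', h2, h3, _⟩ := h1.exists_extension hH hΔ hM k _ _ (by omega)
  exact ⟨S', (produces_iff hk).2 h2, h3⟩

theorem exists_produces {s : X → ℕ} {t : Y → ℕ} {H : Multigraph X Y}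
    (hH : H ∈ multigraphs s t) (hΔ : 2 ≤ maxDeg s t) {k : ℕ} (hk : 2 ≤ k)
    (hM : totalMult (maxDeg s t) (indexOf H) + 2 * (maxDeg s t * (maxDeg s t + k)) < numEdges s)
    (hpos : 0 < indexOf H k) : ∃ S : Switching X Y k, Produces S H := by
  classical
  have := hpos.trans_le (indexOf_le_bZero hH hΔ hk hM)
  obtain ⟨p, hp⟩ := Finset.card_pos.1 this
  obtain ⟨S, hS, _⟩ := (Finset.mem_filter.1 hp).2
  exact ⟨S, hS⟩

/-! ### The reciprocals of the numbers `b_k(H, S)` add up to one -/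

-- Build `f` coordinate by coordinate, each uniform among the values for which some completion
-- satisfies `P`. This never gets stuck, and the product is the probability of ending in `f`. The
-- induction splits off the first coordinate; nothing about `P` matters except that it is
-- satisfiable.
open Classical in
theorem sum_prod_inv_card_eq_one {α : Type*} [Fintype α] (k : ℕ) : ∀ (P : (Fin k → α) → Prop),
    (∃ f, P f) → ∑ f with P f, ∏ j : Fin k,
      ((Finset.univ.filter fun a => ∃ g, P g ∧ (∀ i, i < j → g i = f i) ∧ g j = a).card : ℝ)⁻¹
        = 1 := by
  induction k with
  | zero =>
    rintro P ⟨f, hf⟩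
    have : (Finset.univ.filter fun f => P f) = {f} := by
      ext g
      rw [Subsingleton.elim g f]
      exact iff_of_true (Finset.mem_filter.2 ⟨Finset.mem_univ _, hf⟩) (Finset.mem_singleton_self f)
    rw [this]
    simp
  | succ k ih =>
    intro P hP
    let A : Finset α := Finset.univ.filter fun a => ∃ g : Fin k → α, P (Fin.cons a g)
    have hA0 : A.Nonempty := by
      obtain ⟨f, hf⟩ := hP
      exact ⟨f 0, by simpa [A] using ⟨Fin.tail f, by simpa using hf⟩⟩
    have h0 : ∀ f : Fin (k + 1) → α, (Finset.univ.filter fun a =>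
        ∃ g, P g ∧ (∀ i, i < 0 → g i = f i) ∧ g 0 = a) = A := by
      intro f
      ext a
      simp only [Finset.mem_filter, Finset.mem_univ, true_and, A]
      constructor
      · rintro ⟨g, hg, _, rfl⟩
        exact ⟨Fin.tail g, by simpa using hg⟩
      · rintro ⟨g, hg⟩
        exact ⟨Fin.cons a g, hg, by simp, by simp⟩
    -- Once the first value is `a`, the later counts are those of the predicate `P (Fin.cons a ·)`
    -- on shorter sequences.
    have hs : ∀ (a : α) (f : Fin k → α) (j : Fin k), (Finset.univ.filter fun b =>
        ∃ g, P g ∧ (∀ i, i < j.succ → g i = (Fin.cons a f : Fin (k + 1) → α) i) ∧ g j.succ = b) =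
        Finset.univ.filter fun b => ∃ g : Fin k → α, P (Fin.cons a g) ∧
          (∀ i, i < j → g i = f i) ∧ g j = b := by
      intro a f j
      ext b
      simp only [Finset.mem_filter, Finset.mem_univ, true_and]
      constructor
      · rintro ⟨g, hg, h1, h2⟩
        have h3 : g 0 = a := by simpa using h1 0 (Fin.succ_pos j)
        refine ⟨Fin.tail g, by simpa [← h3] using hg, fun i hi => ?_, h2⟩
        simpa [Fin.tail] using h1 i.succ (Fin.succ_lt_succ_iff.2 hi)
      · rintro ⟨g, hg, h1, h2⟩
        refine ⟨Fin.cons a g, hg, fun i => ?_, by simpa using h2⟩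
        refine Fin.cases (by simp) (fun i hi => ?_) i
        simpa using h1 i (Fin.succ_lt_succ_iff.1 hi)
    rw [Finset.sum_filter, ← (Fin.consEquiv fun _ => α).sum_comp, Fintype.sum_prod_type]
    simp only [Fin.consEquiv_apply, Fin.prod_univ_succ, h0, hs]
    have h1 : ∀ a : α, (∑ f : Fin k → α, if P (Fin.cons a f) then (A.card : ℝ)⁻¹ *
        ∏ j : Fin k, ((Finset.univ.filter fun b => ∃ g : Fin k → α, P (Fin.cons a g) ∧
          (∀ i, i < j → g i = f i) ∧ g j = b).card : ℝ)⁻¹ else 0) =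
        if a ∈ A then (A.card : ℝ)⁻¹ else 0 := by
      intro a
      rw [← Finset.sum_filter, ← Finset.mul_sum]
      split_ifs with ha
      · rw [ih (fun f => P (Fin.cons a f)) (by simpa [A] using ha), mul_one]
      · rw [Finset.filter_false_of_mem, Finset.sum_empty, mul_zero]
        intro f _ hf
        exact ha (by simpa [A] using ⟨f, hf⟩)
    refine (Finset.sum_congr rfl fun a _ => h1 a).trans ?_
    rw [← Finset.sum_filter]
    simp [hA0.ne_empty]

open Classical in
theorem sum_inv_bCount_eq_one {k : ℕ} {H : Multigraph X Y}
    (hH : ∃ S : Switching X Y k, Produces S H) :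
    ∑ S : Switching X Y k with Produces S H, ((bCount H S : ℝ))⁻¹ = 1 := by
  let A : Finset (X × Y) := Finset.univ.filter fun p =>
    ∃ S' : Switching X Y k, Produces S' H ∧ S'.1 = p
  have hA0 : A.Nonempty := by
    obtain ⟨S, hS⟩ := hH
    exact ⟨S.1, by simpa [A] using ⟨_, hS⟩⟩
  have hA : bZero k H = A.card := rfl
  have h2 : ∀ (p : X × Y) (f : Fin k → Y × X) (j : Fin k), bSucc H (p, f) j =
      (Finset.univ.filter fun b => ∃ g : Fin k → Y × X, Produces ((p, g) : Switching X Y k) H ∧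
        (∀ i, i < j → g i = f i) ∧ g j = b).card := by
    intro p f j
    rw [bSucc]
    congr 1
    ext b
    simp only [Finset.mem_filter, Finset.mem_univ, true_and]
    constructor
    · rintro ⟨⟨_, g⟩, hg, rfl, h⟩
      exact ⟨g, hg, h⟩
    · rintro ⟨g, hg, h⟩
      exact ⟨(p, g), hg, rfl, h⟩
  rw [Finset.sum_filter, Fintype.sum_prod_type]
  have h1 : ∀ p : X × Y, (∑ f : Fin k → Y × X, if Produces ((p, f) : Switching X Y k) H then
      ((bCount H ((p, f) : Switching X Y k) : ℝ))⁻¹ else 0) =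
        if p ∈ A then (A.card : ℝ)⁻¹ else 0 := by
    intro p
    simp only [bCount, hA, h2, Nat.cast_mul, Nat.cast_prod, mul_inv, ← Finset.prod_inv_distrib]
    rw [← Finset.sum_filter, ← Finset.mul_sum]
    split_ifs with ha
    · have := sum_prod_inv_card_eq_one k (fun f => Produces ((p, f) : Switching X Y k) H)
        (by simpa [A] using ha)
      refine (congrArg _ (Eq.trans ?_ this)).trans (mul_one _)
      congr!
    · rw [Finset.filter_false_of_mem, Finset.sum_empty, mul_zero]
      intro f _ hf
      exact ha (by simpa [A] using ⟨f, hf⟩)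
  rw [Finset.sum_congr rfl fun p _ => h1 p, ← Finset.sum_filter]
  simp [hA0.ne_empty]

/-! ### Stratum indices -/

theorem topIndex_mem {Δ : ℕ} (hΔ : 2 ≤ Δ) (m : Index) : topIndex Δ m ∈ Finset.Icc 2 Δ := by
  refine Finset.mem_Icc.2 ⟨le_max_left _ _, max_le hΔ (Finset.sup_le fun k hk => ?_)⟩
  exact (Finset.mem_Icc.1 (Finset.mem_filter.1 hk).1).2

theorem topIndex_le_iff {Δ k : ℕ} (m : Index) :
    topIndex Δ m ≤ k ↔ 2 ≤ k ∧ ∀ i ∈ Finset.Icc 2 Δ, 0 < m i → i ≤ k := by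
  simp [topIndex, Finset.sup_le_iff]

/-- Because multiplicities are added in nondecreasing order, the last one can be read off the
current index; thus τ always equals ℓ(m). -/
theorem topIndex_add_unitIndex {Δ k : ℕ} {m : Index} (hk : k ∈ Finset.Icc (topIndex Δ m) Δ) :
    topIndex Δ (m + unitIndex k) = k := by
  obtain ⟨h1, h2⟩ := Finset.mem_Icc.1 hk
  obtain ⟨h3, h4⟩ := (topIndex_le_iff m).1 h1
  refine le_antisymm ((topIndex_le_iff _).2 ⟨h3, fun i hi hpos => ?_⟩) ?_
  · by_cases hik : i = k
    · exact hik.le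
    · exact h4 i hi (by simpa [unitIndex, hik] using hpos)
  · exact ((topIndex_le_iff _).1 le_rfl).2 k (Finset.mem_Icc.2 ⟨h3, h2⟩) (by simp [unitIndex])

theorem topIndex_zero (Δ : ℕ) : topIndex Δ 0 = 2 := by simp [topIndex]

theorem totalMult_congr {Δ : ℕ} {m m' : Index} (h : ∀ i ∈ Finset.Icc 2 Δ, m i = m' i) :
    totalMult Δ m = totalMult Δ m' :=
  Finset.sum_congr rfl fun i hi => by rw [h i hi]

/-! ### Bounds on the parameters -/

theorem numEdges_pos {s : X → ℕ} {t : Y → ℕ} (hst : ∑ x, s x = ∑ y, t y)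
    (hΔ : 2 ≤ maxDeg s t) : 0 < numEdges s := by
  by_contra h
  have h0 : ∑ x, s x = 0 := by
    rw [numEdges] at h
    omega
  have h1 := h0
  rw [hst] at h1
  simp only [Finset.sum_eq_zero_iff, Finset.mem_univ, true_imp_iff] at h0 h1
  have : maxDeg s t ≤ 0 := max_le (Finset.sup_le fun x _ => (h0 x).le)
    (Finset.sup_le fun y _ => (h1 y).le)
  omega

/-- The standing hypotheses on the degree sequences and the threshold. -/
structure Admissible (s : X → ℕ) (t : Y → ℕ) (t₀ : ℕ) : Prop where
  sum_eq : ∑ x, s x = ∑ y, t y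
  two_le : 2 ≤ maxDeg s t
  threshold : IsThreshold s t t₀

/-- The upper bound `Δ^{2k-2} / (M^{k-2} ε^k)` for `f̄_k / b̲_k`. -/
def ratioBound (s : X → ℕ) (t : Y → ℕ) (t₀ k : ℕ) : ℝ :=
  (maxDeg s t : ℝ) ^ (2 * k - 2) / ((numEdges s : ℝ) ^ (k - 2) * eps s t t₀ ^ k)

namespace Admissible

variable {s : X → ℕ} {t : Y → ℕ} {t₀ : ℕ}

theorem numEdges_pos (h : Admissible s t t₀) : (0 : ℝ) < numEdges s :=
  Nat.cast_pos.2 (BipartiteGen.numEdges_pos h.sum_eq h.two_le)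

theorem two_le_cast (h : Admissible s t t₀) : (2 : ℝ) ≤ maxDeg s t := by
  exact_mod_cast h.two_le

theorem eps_pos (h : Admissible s t t₀) : 0 < eps s t t₀ := by
  by_contra h0
  have h1 : eps s t t₀ ^ 3 ≤ 0 := Odd.pow_nonpos (by decide) (not_lt.1 h0)
  have h2 := h.threshold.eps_cube
  have h3 : (0 : ℝ) ≤ 4 * (maxDeg s t : ℝ) ^ 4 / (numEdges s : ℝ) := by positivity
  linarith

theorem eps_le_one (_ : Admissible s t t₀) : eps s t t₀ ≤ 1 := by
  have : (0 : ℝ) ≤ ((t₀ : ℝ) + 4 * (maxDeg s t : ℝ) ^ 2) / (numEdges s : ℝ) := by positivity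
  rw [eps]
  linarith

theorem eps_mul (h : Admissible s t t₀) :
    eps s t t₀ * numEdges s = numEdges s - t₀ - 4 * (maxDeg s t : ℝ) ^ 2 := by
  have := h.numEdges_pos.ne'
  rw [eps]
  field_simp
  ring

theorem eps_mul_pos (h : Admissible s t t₀) : 0 < eps s t t₀ * numEdges s :=
  mul_pos h.eps_pos h.numEdges_pos

theorem four_mul_pow_lt (h : Admissible s t t₀) :
    4 * (maxDeg s t : ℝ) ^ 4 < numEdges s * eps s t t₀ ^ 3 := by
  have := h.threshold.eps_cube
  rwa [div_lt_iff₀ h.numEdges_pos, mul_comm (eps s t t₀ ^ 3)] at this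

theorem ratioBound_pos (h : Admissible s t t₀) (k : ℕ) : 0 < ratioBound s t t₀ k := by
  have h1 := h.numEdges_pos
  have h2 := h.eps_pos
  have h3 := h.two_le_cast
  unfold ratioBound
  positivity

/-- The quotient of consecutive terms is Δ²/(Mε). From Mε ≥ Mε³ > 4Δ⁴ and Δ² ≥ 4 it is at most 1/16.
-/
theorem ratioBound_succ_le (h : Admissible s t t₀) {k : ℕ} (hk : 2 ≤ k) :
    ratioBound s t t₀ (k + 1) ≤ ratioBound s t t₀ k / 16 := by
  have h1 := h.numEdges_pos
  have h2 := h.eps_pos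
  have h3 := h.two_le_cast
  have h4 := h.four_mul_pow_lt
  have h5 := h.eps_le_one
  have h6 : 16 * (maxDeg s t : ℝ) ^ 2 ≤ numEdges s * eps s t t₀ := by
    have h7 : eps s t t₀ ^ 3 ≤ eps s t t₀ := by
      simpa using pow_le_pow_of_le_one h2.le h5 (show 1 ≤ 3 by norm_num)
    have h8 : (numEdges s : ℝ) * eps s t t₀ ^ 3 ≤ numEdges s * eps s t t₀ := by gcongr
    have h9 : (4 : ℝ) ≤ (maxDeg s t : ℝ) ^ 2 := by nlinarith
    nlinarith
  obtain ⟨k, rfl⟩ := Nat.exists_eq_add_of_le' hk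
  have e1 : 2 * (k + 2 + 1) - 2 = 2 * (k + 2) - 2 + 2 := by omega
  have e2 : k + 2 + 1 - 2 = k + 1 := by omega
  have e3 : k + 2 - 2 = k := by omega
  unfold ratioBound
  rw [e1, e2, e3, div_div, div_le_div_iff₀ (by positivity) (by positivity)]
  calc _ = ((maxDeg s t : ℝ) ^ (2 * (k + 2) - 2) * ((numEdges s : ℝ) ^ k * eps s t t₀ ^ (k + 2))) *
        (16 * (maxDeg s t : ℝ) ^ 2) := by ring
    _ ≤ ((maxDeg s t : ℝ) ^ (2 * (k + 2) - 2) * ((numEdges s : ℝ) ^ k * eps s t t₀ ^ (k + 2))) *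
        (numEdges s * eps s t t₀) := by gcongr
    _ = _ := by ring

/-- For k = 3 this is the threshold condition ε³ > 4Δ⁴/M; larger k follow by the decay. -/
theorem ratioBound_le (h : Admissible s t t₀) {k : ℕ} (hk : 3 ≤ k) :
    4 * ratioBound s t t₀ k ≤ 1 := by
  induction k, hk using Nat.le_induction with
  | base =>
    have h1 := h.numEdges_pos
    have h2 := h.eps_pos
    have h4 := h.four_mul_pow_lt
    unfold ratioBound
    rw [← mul_div_assoc, div_le_one (by positivity)]
    simpa using h4.le
  | succ k hk ih =>
    have := h.ratioBound_succ_le (k := k) (by omega)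
    have := h.ratioBound_pos k
    linarith

theorem sum_ratioBound_le (h : Admissible s t t₀) {l : ℕ} (hl : 2 ≤ l) (n : ℕ) :
    ∑ k ∈ Finset.Icc l n, ratioBound s t t₀ k ≤ 2 * ratioBound s t t₀ l := by
  rcases Nat.lt_or_ge n l with hn | hn
  · rw [Finset.Icc_eq_empty (by omega), Finset.sum_empty]
    linarith [h.ratioBound_pos l]
  -- The subtracted next term makes the bound inductive.
  · have : ∑ k ∈ Finset.Icc l n, ratioBound s t t₀ k ≤
        2 * ratioBound s t t₀ l - 2 * ratioBound s t t₀ (n + 1) := by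
      induction n, hn using Nat.le_induction with
      | base =>
        rw [Finset.Icc_self, Finset.sum_singleton]
        linarith [h.ratioBound_succ_le hl, h.ratioBound_pos l]
      | succ n hn ih =>
        rw [Finset.sum_Icc_succ_top (by omega)]
        linarith [h.ratioBound_succ_le (k := n + 1) (by omega), h.ratioBound_pos (n + 1)]
    linarith [h.ratioBound_pos (n + 1)]

theorem eps_mul_le_bLowerAt (h : Admissible s t t₀) {k : ℕ} (hk : k ∈ Finset.Icc 2 (maxDeg s t))
    {m : Index} (hm : totalMult (maxDeg s t) m < t₀) {i : ℕ} (hi : 1 ≤ i) (hik : i ≤ k) :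
    eps s t t₀ * numEdges s ≤ bLowerAt s t t₀ k m i := by
  have h0 := h.numEdges_pos.ne'
  rw [bLowerAt, if_neg (by omega)]
  split_ifs with h2
  · rw [h.eps_mul, mul_sub, mul_div_cancel₀ _ h0]
    have h3 : (i : ℝ) ≤ maxDeg s t := by exact_mod_cast hik.trans (Finset.mem_Icc.1 hk).2
    have h4 : (totalMult (maxDeg s t) m : ℝ) ≤ t₀ := by exact_mod_cast hm.le
    nlinarith [h.two_le_cast]
  · exact le_rfl

theorem bLower_pos (h : Admissible s t t₀) {k : ℕ} (hk : k ∈ Finset.Icc 2 (maxDeg s t))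
    {m : Index} (hm : totalMult (maxDeg s t) m < t₀) (hmk : 0 < m k) :
    0 < bLower s t t₀ k m := by
  refine Finset.prod_pos fun i hi => ?_
  rcases Nat.eq_zero_or_pos i with rfl | hi0
  · simpa [bLowerAt] using hmk
  · exact h.eps_mul_pos.trans_le
      (h.eps_mul_le_bLowerAt hk hm hi0 (Nat.lt_succ_iff.1 (Finset.mem_range.1 hi)))

theorem fUpper_le (h : Admissible s t t₀) {k : ℕ} (hk : 1 ≤ k) :
    fUpper s t k ≤ (numEdges s : ℝ) ^ 2 * (maxDeg s t : ℝ) ^ (2 * k - 2) := by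
  have h1 : (moment k s : ℝ) ≤ numEdges s * (maxDeg s t : ℝ) ^ (k - 1) := by
    exact_mod_cast moment_le s (le_maxDeg_left s t) hk
  have h2 : (moment k t : ℝ) ≤ numEdges s * (maxDeg s t : ℝ) ^ (k - 1) := by
    have := moment_le t (le_maxDeg_right s t) hk
    rw [← h.sum_eq] at this
    exact_mod_cast this
  calc fUpper s t k ≤ (numEdges s * (maxDeg s t : ℝ) ^ (k - 1)) *
        (numEdges s * (maxDeg s t : ℝ) ^ (k - 1)) := by
        unfold fUpper
        gcongr
    _ = (numEdges s : ℝ) ^ 2 * (maxDeg s t : ℝ) ^ ((k - 1) + (k - 1)) := by ring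
    _ = _ := by
        congr 2
        omega

theorem fUpper_nonneg (s : X → ℕ) (t : Y → ℕ) (k : ℕ) : 0 ≤ fUpper s t k := by
  unfold fUpper
  positivity

/-- Here b̲_k(m + e_k) = (m_k + 1)(εM)^k, and the factor m_k + 1 is dropped. For k ≥ 3 the other
factors do not involve S(m), so no threshold bound on `m` is needed. -/
theorem fUpper_div_bLower_le (h : Admissible s t t₀) {k : ℕ} (hk : 3 ≤ k) (m : Index) :
    fUpper s t k / bLower s t t₀ k (m + unitIndex k) ≤ ratioBound s t t₀ k := by
  have h1 := h.numEdges_pos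
  have h2 := h.eps_pos
  have hb : bLower s t t₀ k (m + unitIndex k) =
      ((m k : ℝ) + 1) * (eps s t t₀ * numEdges s) ^ k := by
    rw [bLower, Finset.prod_range_succ', mul_comm]
    congr 1
    · simp [bLowerAt, unitIndex]
    · rw [Finset.prod_eq_pow_card (b := eps s t t₀ * numEdges s), Finset.card_range]
      intro i _
      rw [bLowerAt, if_neg (by omega), if_neg (by omega)]
  have hb' : (eps s t t₀ * numEdges s) ^ k ≤ bLower s t t₀ k (m + unitIndex k) := by
    rw [hb]
    refine le_mul_of_one_le_left (by positivity) ?_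
    have : (0 : ℝ) ≤ m k := Nat.cast_nonneg _
    linarith
  calc _ ≤ ((numEdges s : ℝ) ^ 2 * (maxDeg s t : ℝ) ^ (2 * k - 2)) /
        (eps s t t₀ * numEdges s) ^ k := by
        have := h.fUpper_le (k := k) (by omega)
        gcongr
    _ = ratioBound s t t₀ k := by
        obtain ⟨k, rfl⟩ := Nat.exists_eq_add_of_le' (show 2 ≤ k by omega)
        unfold ratioBound
        rw [show k + 2 - 2 = k by omega, mul_pow, pow_add (numEdges s : ℝ)]
        field_simp

theorem beta_of_le {m : Index} (hm : t₀ ≤ totalMult (maxDeg s t) m) : beta s t t₀ m = -1 := by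
  rw [beta, if_pos hm]

theorem beta_of_three_le {m : Index} (hm : totalMult (maxDeg s t) m < t₀)
    (htop : 3 ≤ topIndex (maxDeg s t) m) :
    beta s t t₀ m = 4 * ratioBound s t t₀ (topIndex (maxDeg s t) m) := by
  rw [beta, if_neg (by omega), if_pos htop, ratioBound, mul_div_assoc]

theorem beta_of_top_eq_two {m : Index} (hm : totalMult (maxDeg s t) m < t₀)
    (htop : topIndex (maxDeg s t) m = 2) :
    beta s t t₀ m = ∑ k ∈ Finset.Icc 2 (maxDeg s t),
      fUpper s t k / bLower s t t₀ k (m + unitIndex k) * (1 + beta s t t₀ (m + unitIndex k)) := by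
  rw [beta, if_neg (by omega), if_neg (by omega)]
  exact Finset.sum_coe_sort (Finset.Icc 2 (maxDeg s t)) fun k =>
    fUpper s t k / bLower s t t₀ k (m + unitIndex k) * (1 + beta s t t₀ (m + unitIndex k))

/-- Past the threshold β = −1 annihilates the term, whatever the sign of b̲. -/
theorem term_nonneg (h : Admissible s t t₀) {k : ℕ} (hk : k ∈ Finset.Icc 2 (maxDeg s t))
    {m : Index} (hb : totalMult (maxDeg s t) (m + unitIndex k) < t₀ →
      0 ≤ beta s t t₀ (m + unitIndex k)) :
    0 ≤ fUpper s t k / bLower s t t₀ k (m + unitIndex k) *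
      (1 + beta s t t₀ (m + unitIndex k)) := by
  rcases Nat.lt_or_ge (totalMult (maxDeg s t) (m + unitIndex k)) t₀ with h1 | h1
  · have h2 := h.bLower_pos hk h1 (by simp [unitIndex])
    have h3 := fUpper_nonneg s t k
    have h4 := hb h1
    positivity
  · rw [beta_of_le h1]
    simp

theorem beta_nonneg (h : Admissible s t t₀) {m : Index}
    (hm : totalMult (maxDeg s t) m < t₀) : 0 ≤ beta s t t₀ m := by
  induction hd : t₀ - totalMult (maxDeg s t) m using Nat.strong_induction_on generalizing m with
  | _ d ih =>
    have h2 := (Finset.mem_Icc.1 (topIndex_mem h.two_le m)).1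
    rcases h2.lt_or_eq with h3 | h3
    · rw [beta_of_three_le hm h3]
      have := h.ratioBound_pos (topIndex (maxDeg s t) m)
      positivity
    · rw [beta_of_top_eq_two hm h3.symm]
      refine Finset.sum_nonneg fun k hk => h.term_nonneg hk fun h1 => ?_
      have h4 := totalMult_add_unitIndex hk m
      have h5 := (Finset.mem_Icc.1 hk).1
      exact ih _ (by omega) h1 rfl

theorem chooseProb_eq (m : Index) (k : ℕ) : chooseProb s t t₀ m k =
    fUpper s t k / bLower s t t₀ k (m + unitIndex k) * (1 + beta s t t₀ (m + unitIndex k)) /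
      beta s t t₀ m := by
  rw [chooseProb, mul_div_assoc]

theorem chooseProb_nonneg (h : Admissible s t t₀) {m : Index}
    (hm : totalMult (maxDeg s t) m < t₀) {k : ℕ} (hk : k ∈ Finset.Icc 2 (maxDeg s t)) :
    0 ≤ chooseProb s t t₀ m k := by
  rw [chooseProb_eq]
  exact div_nonneg (h.term_nonneg hk fun h1 => h.beta_nonneg h1) (h.beta_nonneg hm)

/-- If ℓ(m) = 2, the numerators add up to β_m by definition. If ℓ(m) ≥ 3, write r_k for
`ratioBound`: each numerator is at most r_k(1 + 4r_k) ≤ 2r_k, and the geometric decay bounds their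
sum by 4r_ℓ = β_m. -/
theorem sum_chooseProb_le (h : Admissible s t t₀) {m : Index}
    (hm : totalMult (maxDeg s t) m < t₀) :
    ∑ k ∈ Finset.Icc (topIndex (maxDeg s t) m) (maxDeg s t), chooseProb s t t₀ m k ≤ 1 := by
  simp only [chooseProb_eq, ← Finset.sum_div]
  refine div_le_one_of_le₀ ?_ (h.beta_nonneg hm)
  have h2 := (Finset.mem_Icc.1 (topIndex_mem h.two_le m)).1
  rcases h2.lt_or_eq with h3 | h3
  · rw [beta_of_three_le hm h3]
    calc _ ≤ ∑ k ∈ Finset.Icc (topIndex (maxDeg s t) m) (maxDeg s t),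
          2 * ratioBound s t t₀ k := by
          refine Finset.sum_le_sum fun k hk => ?_
          have h4 := (Finset.mem_Icc.1 hk).1
          have h5 := h.ratioBound_pos k
          rcases Nat.lt_or_ge (totalMult (maxDeg s t) (m + unitIndex k)) t₀ with h1 | h1
          · have h6 : beta s t t₀ (m + unitIndex k) = 4 * ratioBound s t t₀ k := by
              rw [beta_of_three_le h1] <;> rw [topIndex_add_unitIndex hk]
              omega
            have h7 := h.ratioBound_le (k := k) (by omega)
            have h8 := h.fUpper_div_bLower_le (k := k) (by omega) m
            rw [h6, mul_comm 2]
            gcongr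
            linarith
          · rw [beta_of_le h1]
            simp only [add_neg_cancel, mul_zero]
            positivity
      _ ≤ _ := by
          rw [← Finset.mul_sum]
          linarith [h.sum_ratioBound_le h2 (maxDeg s t)]
  · rw [← h3, ← beta_of_top_eq_two hm h3.symm]

/-- Handles division by β_m = 0: all terms of the defining sum vanish, and below the threshold only
f̄_k can be the zero factor, so no `k`-switching exists. -/
theorem fUpper_eq_zero_of_beta_eq_zero (h : Admissible s t t₀) {m : Index}
    (hm : totalMult (maxDeg s t) m < t₀) (hb : beta s t t₀ m = 0) {k : ℕ}
    (hk : k ∈ Finset.Icc 2 (maxDeg s t))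
    (hmk : totalMult (maxDeg s t) (m + unitIndex k) < t₀) : fUpper s t k = 0 := by
  have h2 := (Finset.mem_Icc.1 (topIndex_mem h.two_le m)).1
  rcases h2.lt_or_eq with h3 | h3
  · rw [beta_of_three_le hm h3] at hb
    linarith [h.ratioBound_pos (topIndex (maxDeg s t) m)]
  · rw [beta_of_top_eq_two hm h3.symm, Finset.sum_eq_zero_iff_of_nonneg fun k hk =>
      h.term_nonneg hk fun h1 => h.beta_nonneg h1] at hb
    have h4 := hb k hk
    have h5 := h.beta_nonneg hmk
    have h6 := h.bLower_pos hk hmk (by simp [unitIndex])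
    have h7 : 1 + beta s t t₀ (m + unitIndex k) ≠ 0 := by positivity
    simpa [h7, h6.ne'] using h4

/-! ### Well-definedness of Gen -/

theorem totalMult_add_lt_numEdges (h : Admissible s t t₀) {k : ℕ} (hk : k ≤ maxDeg s t)
    {m : Index} (hm : totalMult (maxDeg s t) m < t₀) :
    totalMult (maxDeg s t) m + 2 * (maxDeg s t * (maxDeg s t + k)) < numEdges s := by
  have h1 := h.eps_mul_pos
  rw [h.eps_mul] at h1
  have h2 : (t₀ : ℝ) + 4 * (maxDeg s t : ℝ) ^ 2 < numEdges s := by linarith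
  have h3 : t₀ + 4 * (maxDeg s t) ^ 2 < numEdges s := by exact_mod_cast h2
  nlinarith

theorem bLower_le_bCount (h : Admissible s t t₀) {k : ℕ} (hk : k ∈ Finset.Icc 2 (maxDeg s t))
    {H : Multigraph X Y} (hH : H ∈ multigraphs s t) {m : Index}
    (hHm : ∀ i ∈ Finset.Icc 2 (maxDeg s t), indexOf H i = m i)
    (hm : totalMult (maxDeg s t) m < t₀) {S : Switching X Y k} (hS : Produces S H) :
    bLower s t t₀ k m ≤ bCount H S := by
  obtain ⟨hk2, hkΔ⟩ := Finset.mem_Icc.1 hk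
  have hT := totalMult_congr hHm
  have hM := h.totalMult_add_lt_numEdges hkΔ hm
  rw [← hT] at hM
  rw [bLower, Finset.prod_range_succ', bCount, mul_comm, Nat.cast_mul, Nat.cast_prod,
    ← Fin.prod_univ_eq_prod_range (fun i => bLowerAt s t t₀ k m (i + 1))]
  have h0 : ∀ j : Fin k, 0 ≤ bLowerAt s t t₀ k m (j + 1) := fun j =>
    h.eps_mul_pos.le.trans (h.eps_mul_le_bLowerAt hk hm (by omega) j.2)
  refine mul_le_mul ?_ (Finset.prod_le_prod (fun j _ => h0 j) fun j _ => ?_)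
    (Finset.prod_nonneg fun j _ => h0 j) (Nat.cast_nonneg _)
  · rw [bLowerAt, if_pos rfl, ← hHm k hk]
    exact_mod_cast indexOf_le_bZero hH h.two_le hk2 hM
  · refine le_trans ?_ (Nat.cast_le.2 (card_nextEdges_le_bSucc hH h.two_le hk2 hM hS j))
    have h1 := numEdges_le_card_nextEdges hH h.two_le S j
    rw [hT] at h1
    have h2 : (numEdges s : ℝ) ≤ (nextEdges H S j).card + totalMult (maxDeg s t) m +
      2 * (maxDeg s t * (maxDeg s t + (j : ℕ))) := by exact_mod_cast h1
    have h3 : ((j : ℕ) : ℝ) ≤ maxDeg s t := by exact_mod_cast j.2.le.trans hkΔ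
    have h4 : (totalMult (maxDeg s t) m : ℝ) ≤ t₀ := by exact_mod_cast hm.le
    have h5 := h.two_le_cast
    rw [bLowerAt, if_neg (by omega)]
    split_ifs with h6
    -- Position `j` of `Fin k` corresponds to i = j + 1, so there is a slack of 2Δ against the
    -- counted loss 2Δ(Δ + j).
    · rw [mul_sub, mul_div_cancel₀ _ h.numEdges_pos.ne']
      push_cast
      nlinarith
    · rw [h.eps_mul]
      nlinarith

theorem wellDefined (h : Admissible s t t₀) : WellDefined s t t₀ where
  output_prob m hm := by
    have := h.beta_nonneg hm
    exact ⟨this, by positivity, div_le_one_of_le₀ (by linarith) (by positivity)⟩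
  choose_nonneg m hm k hk := by
    refine h.chooseProb_nonneg hm (Finset.mem_Icc.2 ⟨?_, (Finset.mem_Icc.1 hk).2⟩)
    exact (Finset.mem_Icc.1 (topIndex_mem h.two_le m)).1.trans (Finset.mem_Icc.1 hk).1
  choose_sum_le m hm := h.sum_chooseProb_le hm
  f_prob m k hk hm G hG := by
    have h1 : (fCount k G : ℝ) ≤ fUpper s t k := by
      unfold fUpper
      exact_mod_cast fCount_le hG.1 k
    have h2 := div_le_one_of_le₀ h1 (fUpper_nonneg s t k)
    have h3 := div_nonneg (Nat.cast_nonneg (α := ℝ) (fCount k G)) (fUpper_nonneg s t k)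
    exact ⟨by linarith, by linarith⟩
  b_prob m k hk hm G hG S hS := by
    have hS' : CanPerform G S := by
      classical
      simpa [switchings] using hS
    have hk2 := (Finset.mem_Icc.1 hk).1
    have h1 := h.bLower_le_bCount hk ((perform_mem_multigraphs_iff hS').2 hG.1)
      (m := m + unitIndex k) (fun i hi => by
        rw [indexOf_perform hk2 hS', Pi.add_apply, Pi.add_apply, hG.2 i hi]) hm ⟨G, hS', rfl⟩
    have h2 := div_le_one_of_le₀ h1 (Nat.cast_nonneg _)
    have h3 := div_nonneg (h.bLower_pos hk hm (by simp [unitIndex])).le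
      (Nat.cast_nonneg (α := ℝ) (bCount (perform G S) S))
    exact ⟨by linarith, by linarith⟩

end Admissible

/-! ### Elementary random choices -/

theorem coin_true {p : ℝ} (hp : p ∈ Set.Icc (0 : ℝ) 1) : coin p true = ENNReal.ofReal p := by
  have : ENNReal.ofReal p ≤ 1 := by simpa using hp.2
  simp [coin, this]

theorem coin_false {p : ℝ} (hp : p ∈ Set.Icc (0 : ℝ) 1) :
    coin p false = ENNReal.ofReal (1 - p) := by
  have : ENNReal.ofReal p ≤ 1 := by simpa using hp.2
  simp [coin, this, ENNReal.ofReal_sub _ hp.1]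

theorem chooseOrReject_some {A : Finset ℕ} {p : ℕ → ℝ} (hp : ∀ k ∈ A, 0 ≤ p k)
    (hsum : ∑ k ∈ A, p k ≤ 1) (k : ℕ) :
    chooseOrReject A p (some k) = if k ∈ A then ENNReal.ofReal (p k) else 0 := by
  have h : ∑ k ∈ A, ENNReal.ofReal (p k) ≤ 1 := by
    rw [← ENNReal.ofReal_sum_of_nonneg hp]
    simpa using hsum
  rw [chooseOrReject, dif_pos h]
  simp

/-! ### The transition probabilities of Gen -/

theorem mem_switchings {k : ℕ} {G : Multigraph X Y} {S : Switching X Y k} :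
    S ∈ switchings k G ↔ CanPerform G S := by
  classical
  simp [switchings]

theorem switchStep_output (s : X → ℕ) (t : Y → ℕ) (t₀ : ℕ) (m : Index) (k : ℕ)
    (G H : Multigraph X Y) : switchStep s t t₀ m k G (State.output H) = 0 := by
  unfold switchStep
  split_ifs with h
  · simp only [PMF.bind_apply, ENNReal.tsum_eq_zero, mul_eq_zero]
    refine fun S => Or.inr fun b => Or.inr ?_
    cases b
    · simp only [Bool.false_eq_true, if_false, PMF.bind_apply, ENNReal.tsum_eq_zero, mul_eq_zero]
      intro b
      cases b <;> simp
    · simp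
  · simp

-- The uniform choice 1/f_k(G) cancels against the f-acceptance f_k(G)/f̄_k, so each switching
-- carries weight b̲/(f̄ b), with `G` entering only through its index.
open Classical in
theorem switchStep_running {s : X → ℕ} {t : Y → ℕ} {t₀ : ℕ} (hw : WellDefined s t t₀)
    {G : Multigraph X Y} (hG : G ∈ multigraphs s t) {k : ℕ} (hk : k ∈ Finset.Icc 2 (maxDeg s t))
    (hm : totalMult (maxDeg s t) (indexOf G + unitIndex k) < t₀) (m' : Index) (τ : ℕ)
    (H : Multigraph X Y) :
    switchStep s t t₀ (indexOf G) k G (State.running m' τ H) =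
      if m' = indexOf G + unitIndex k ∧ τ = k then
        ∑ S ∈ switchings k G with perform G S = H,
          ENNReal.ofReal (bLower s t t₀ k (indexOf G + unitIndex k) / fUpper s t k *
            (bCount H S : ℝ)⁻¹)
      else 0 := by
  have hstr : G ∈ stratum s t (indexOf G) := ⟨hG, fun _ _ => rfl⟩
  unfold switchStep
  split_ifs with h h1 h1
  · obtain ⟨rfl, rfl⟩ := h1
    rw [PMF.bind_apply, tsum_fintype, Finset.sum_filter,
      ← Finset.sum_subset (Finset.subset_univ (switchings τ G))]
    · refine Finset.sum_congr rfl fun S hS => ?_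
      rw [PMF.uniformOfFinset_apply_of_mem _ hS, PMF.bind_apply, tsum_bool]
      simp only [Bool.false_eq_true, if_false, if_true, PMF.bind_apply, tsum_bool, PMF.pure_apply]
      rw [coin_false (hw.f_prob _ _ hk hm G hstr), coin_false (hw.b_prob _ _ hk hm G hstr S hS)]
      by_cases hH : perform G S = H
      · subst hH
        have hc : (0 : ℝ) < fCount τ G := Nat.cast_pos.2 (Finset.card_pos.2 h)
        have h2 : ((switchings τ G).card : ℝ≥0∞)⁻¹ = ENNReal.ofReal ((fCount τ G : ℝ)⁻¹) := by
          rw [ENNReal.ofReal_inv_of_pos hc, ENNReal.ofReal_natCast, fCount]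
        have h3 := (hw.f_prob _ _ hk hm G hstr).2
        simp only [if_true, mul_one, reduceCtorEq, if_false, mul_zero, add_zero, h2,
          sub_sub_cancel]
        rw [← ENNReal.ofReal_mul (div_nonneg (Nat.cast_nonneg _) (Admissible.fUpper_nonneg s t τ)),
          ← ENNReal.ofReal_mul (by positivity)]
        congr 1
        field_simp
      · have : ¬ H = perform G S := fun h => hH h.symm
        simp [hH, this]
    · intro S _ hS
      rw [PMF.uniformOfFinset_apply_of_notMem _ hS, zero_mul]
  · simp only [PMF.bind_apply, ENNReal.tsum_eq_zero, mul_eq_zero]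
    refine fun S => Or.inr fun b => Or.inr ?_
    cases b
    · simp only [Bool.false_eq_true, if_false, PMF.bind_apply, ENNReal.tsum_eq_zero, mul_eq_zero]
      intro b
      cases b
      · simp only [Bool.false_eq_true, if_false, PMF.pure_apply, State.running.injEq]
        exact Or.inr (if_neg fun h2 => h1 ⟨h2.1, h2.2.1⟩)
      · simp
    · simp
  · rw [Finset.not_nonempty_iff_eq_empty.1 h]
    simp
  · simp

open Classical in
theorem step_running {s : X → ℕ} {t : Y → ℕ} {t₀ : ℕ} (h : Admissible s t t₀)
    {G : Multigraph X Y} (hG : G ∈ multigraphs s t)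
    (hm : totalMult (maxDeg s t) (indexOf G) < t₀) (m' : Index) (k : ℕ) (H : Multigraph X Y) :
    step s t t₀ (State.running (indexOf G) (topIndex (maxDeg s t) (indexOf G)) G)
        (State.running m' k H) =
      if k ∈ Finset.Icc (topIndex (maxDeg s t) (indexOf G)) (maxDeg s t) ∧
          m' = indexOf G + unitIndex k ∧ totalMult (maxDeg s t) m' < t₀ then
        ENNReal.ofReal (1 - 1 / (1 + beta s t t₀ (indexOf G))) *
          (ENNReal.ofReal (chooseProb s t t₀ (indexOf G) k) *
            ∑ S ∈ switchings k G with perform G S = H,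
              ENNReal.ofReal (bLower s t t₀ k m' / fUpper s t k * (bCount H S : ℝ)⁻¹))
      else 0 := by
  have hw := h.wellDefined
  have htop := (Finset.mem_Icc.1 (topIndex_mem h.two_le (indexOf G))).1
  have key : ∀ j, j ∈ Finset.Icc (topIndex (maxDeg s t) (indexOf G)) (maxDeg s t) →
      ENNReal.ofReal (chooseProb s t t₀ (indexOf G) j) *
        switchStep s t t₀ (indexOf G) j G (State.running m' k H) =
      if j = k ∧ m' = indexOf G + unitIndex k ∧ totalMult (maxDeg s t) m' < t₀ then
        ENNReal.ofReal (chooseProb s t t₀ (indexOf G) k) *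
            ∑ S ∈ switchings k G with perform G S = H,
              ENNReal.ofReal (bLower s t t₀ k m' / fUpper s t k * (bCount H S : ℝ)⁻¹)
      else 0 := by
    intro j hj
    have hj2 : j ∈ Finset.Icc 2 (maxDeg s t) := by
      simp only [Finset.mem_Icc] at hj ⊢
      omega
    rcases Nat.lt_or_ge (totalMult (maxDeg s t) (indexOf G + unitIndex j)) t₀ with h1 | h1
    · rw [switchStep_running hw hG hj2 h1]
      by_cases h2 : m' = indexOf G + unitIndex j ∧ k = j
      · obtain ⟨rfl, rfl⟩ := h2
        rw [if_pos ⟨rfl, rfl⟩, if_pos ⟨rfl, rfl, h1⟩]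
      · rw [if_neg h2, if_neg, mul_zero]
        rintro ⟨rfl, h3, _⟩
        exact h2 ⟨h3, rfl⟩
    -- A choice that would reach the threshold has probability 0 since 1 + β = 0; the rejection
    -- probabilities there are never needed.
    · have h2 : chooseProb s t t₀ (indexOf G) j = 0 := by
        rw [Admissible.chooseProb_eq, Admissible.beta_of_le h1]
        simp
      rw [h2, if_neg]
      · simp
      · rintro ⟨rfl, rfl, h3⟩
        omega
  rw [step, if_pos hm, PMF.bind_apply, tsum_bool]
  simp only [Bool.false_eq_true, if_false, if_true, PMF.pure_apply, reduceCtorEq, mul_zero,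
    add_zero]
  rw [coin_false (hw.output_prob _ hm).2, PMF.bind_apply, tsum_eq_single (some k)]
  · rw [chooseOrReject_some (hw.choose_nonneg _ hm) (hw.choose_sum_le _ hm)]
    split_ifs with h1 h2 h2
    · rw [key k h1, if_pos ⟨rfl, h2.2⟩]
    · rw [key k h1, if_neg fun h3 => h2 ⟨h1, h3.2⟩, mul_zero]
    · exact absurd h2.1 h1
    · simp
  · intro o ho
    cases o with
    | none => simp
    | some j =>
      rw [chooseOrReject_some (hw.choose_nonneg _ hm) (hw.choose_sum_le _ hm)]
      split_ifs with h1
      · simp only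
        rw [key j h1, if_neg]
        rintro ⟨rfl, _⟩
        exact ho rfl
      · simp

open Classical in
theorem step_output {s : X → ℕ} {t : Y → ℕ} {t₀ : ℕ} (hw : WellDefined s t t₀) (m : Index) (τ : ℕ)
    (G H : Multigraph X Y) :
    step s t t₀ (State.running m τ G) (State.output H) =
      if totalMult (maxDeg s t) m < t₀ ∧ G = H then
        ENNReal.ofReal (1 / (1 + beta s t t₀ m)) else 0 := by
  rw [step]
  by_cases hm : totalMult (maxDeg s t) m < t₀
  · rw [if_pos hm, PMF.bind_apply, tsum_bool, coin_true (hw.output_prob _ hm).2]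
    simp only [Bool.false_eq_true, if_false, if_true, PMF.pure_apply, State.output.injEq, hm,
      true_and]
    have hbind : ∀ (p : PMF (Option ℕ)) (f : Option ℕ → PMF (State X Y)),
        (∀ o, f o (State.output H) = 0) → (p.bind f) (State.output H) = 0 := by
      intro p f hf
      simp [PMF.bind_apply, hf]
    rw [hbind, mul_zero, zero_add]
    swap
    · intro o
      cases o with
      | none => simp
      | some k => exact switchStep_output s t t₀ m k G H
    by_cases h : G = H
    · simp [h]
    · rw [if_neg h, if_neg fun h' => h h'.symm, mul_zero]
  · simp [hm]

/-! ### The law of the state of Gen -/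

/-- The number of multiple edges in a stratum, which is the number of iterations after which Gen
reaches it. -/
def numMultiple (Δ : ℕ) (m : Index) : ℕ := ∑ i ∈ Finset.Icc 2 Δ, m i

theorem numMultiple_add_unitIndex {Δ k : ℕ} (hk : k ∈ Finset.Icc 2 Δ) (m : Index) :
    numMultiple Δ (m + unitIndex k) = numMultiple Δ m + 1 := by
  simp only [numMultiple, unitIndex, Pi.add_apply, Finset.sum_add_distrib,
    Pi.single_apply]
  simp [Finset.mem_Icc.1 hk]

theorem numMultiple_indexOf_eq_zero_iff {s : X → ℕ} {t : Y → ℕ} {G : Multigraph X Y}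
    (hG : G ∈ multigraphs s t) : numMultiple (maxDeg s t) (indexOf G) = 0 ↔ indexOf G = 0 := by
  constructor
  · intro h
    funext i
    by_cases hi : i ∈ Finset.Icc 2 (maxDeg s t)
    · exact (Finset.sum_eq_zero_iff.1 h) i hi
    · exact indexOf_eq_zero hG hi
  · intro h
    simp [h, numMultiple]

/-- The preceding stratum index is obtained by removing one edge of the largest multiplicity, which
occurs in `m` because `m` has a multiple edge. -/
theorem exists_eq_add_unitIndex {Δ : ℕ} (hΔ : 2 ≤ Δ) {m : Index} (hm : 0 < numMultiple Δ m) :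
    ∃ m₀ : Index, m = m₀ + unitIndex (topIndex Δ m) ∧
      topIndex Δ m ∈ Finset.Icc (topIndex Δ m₀) Δ := by
  have hpos : 0 < m (topIndex Δ m) := by
    by_contra h0
    obtain ⟨i, hi, hmi⟩ : ∃ i ∈ Finset.Icc 2 Δ, 0 < m i := by
      by_contra h
      push Not at h
      exact hm.ne' (Finset.sum_eq_zero fun i hi => Nat.le_zero.1 (h i hi))
    have h1 := (topIndex_le_iff (Δ := Δ) m).1 le_rfl
    have h2 : topIndex Δ m ≤ topIndex Δ m - 1 := by
      refine (topIndex_le_iff m).2 ⟨?_, fun j hj hmj => ?_⟩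
      · have h3 := h1.2 i hi hmi
        have h4 : i ≠ topIndex Δ m := fun h => h0 (h ▸ hmi)
        have := (Finset.mem_Icc.1 hi).1
        omega
      · have h3 := h1.2 j hj hmj
        have h4 : j ≠ topIndex Δ m := fun h => h0 (h ▸ hmj)
        omega
    have := h1.1
    omega
  refine ⟨m - unitIndex (topIndex Δ m), ?_, Finset.mem_Icc.2 ⟨?_, ?_⟩⟩
  · funext i
    by_cases hi : i = topIndex Δ m
    · subst hi
      simp only [Pi.add_apply, Pi.sub_apply, unitIndex, Pi.single_eq_same]
      omega
    · simp [unitIndex, hi]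
  · have h1 := (topIndex_le_iff (Δ := Δ) m).1 le_rfl
    refine (topIndex_le_iff _).2 ⟨h1.1, fun i hi hmi => h1.2 i hi ?_⟩
    simp only [Pi.sub_apply] at hmi
    omega
  · exact (Finset.mem_Icc.1 (topIndex_mem hΔ m)).2

/-- The probability that Gen visits a given multigraph of the stratum of `m`. -/
def visitProb (s : X → ℕ) (t : Y → ℕ) (t₀ : ℕ) (m : Index) : ℝ :=
  (1 + beta s t t₀ m) / ((1 + beta s t t₀ 0) * ((stratum s t 0).ncard : ℝ))

/-- For infinite `A` too, `ncard` would be 0, giving a point of the support mass `⊤`. -/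
theorem IsUniformOn.ncard_pos {α : Type*} {μ : PMF α} {A : Set α} (h : IsUniformOn μ A) :
    0 < A.ncard := by
  obtain ⟨a, ha⟩ := μ.support_nonempty
  have h1 : μ a ≠ 0 := ha
  have h2 := μ.coe_le_one a
  rw [h a] at h1 h2
  split_ifs at h1 h2
  · refine Nat.pos_of_ne_zero fun h0 => ?_
    simp [h0] at h2
  · exact absurd rfl h1

theorem sum_produces_eq {s : X → ℕ} {t : Y → ℕ} {t₀ : ℕ} (h : Admissible s t t₀)
    {N : ℝ} {m₀ : Index} {k : ℕ} (hk : k ∈ Finset.Icc 2 (maxDeg s t))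
    (hm : totalMult (maxDeg s t) (m₀ + unitIndex k) < t₀) (hf : 0 < fUpper s t k) :
    (1 + beta s t t₀ m₀) / N * ((1 - 1 / (1 + beta s t t₀ m₀)) *
      (chooseProb s t t₀ m₀ k * (bLower s t t₀ k (m₀ + unitIndex k) / fUpper s t k))) =
    (1 + beta s t t₀ (m₀ + unitIndex k)) / N := by
  have hm₀ : totalMult (maxDeg s t) m₀ < t₀ := by
    rw [totalMult_add_unitIndex hk] at hm
    omega
  have h1 := h.beta_nonneg hm₀
  have h2 : beta s t t₀ m₀ ≠ 0 := fun h0 =>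
    hf.ne' (h.fUpper_eq_zero_of_beta_eq_zero hm₀ h0 hk hm)
  have h3 := (h.bLower_pos hk hm (by simp [unitIndex])).ne'
  have h4 : 1 + beta s t t₀ m₀ ≠ 0 := by positivity
  rw [Admissible.chooseProb_eq]
  have h5 := hf.ne'
  have h6 : (1 : ℝ) - 1 / (1 + beta s t t₀ m₀) = beta s t t₀ m₀ / (1 + beta s t t₀ m₀) := by
    field_simp
    ring
  rw [h6]
  field_simp

open Classical in
/-- Summing the transition probabilities over all predecessors of a multigraph. -/
theorem tsum_sum_switchings {k : ℕ} (hk : 2 ≤ k) (H : Multigraph X Y)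
    (w : Switching X Y k → ℝ≥0∞) :
    ∑' G : Multigraph X Y, ∑ S ∈ switchings k G with perform G S = H, w S =
      ∑ S : Switching X Y k with Produces S H, w S := by
  have h1 : ∀ G : Multigraph X Y, ∑ S ∈ switchings k G with perform G S = H, w S =
      ∑ S : Switching X Y k, if Produces S H ∧ G = undo H S then w S else 0 := by
    intro G
    rw [← Finset.sum_filter]
    refine Finset.sum_congr ?_ fun _ _ => rfl
    ext S
    simp only [Finset.mem_filter, mem_switchings, Finset.mem_univ, true_and]
    exact canPerform_and_perform_eq_iff hk
  rw [tsum_congr h1, Summable.tsum_finsetSum fun _ _ => ENNReal.summable, Finset.sum_filter]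
  refine Finset.sum_congr rfl fun S _ => ?_
  rw [tsum_eq_single (undo H S)]
  · simp
  · intro G hG
    simp [hG]

open Classical in
theorem stateLaw_running {s : X → ℕ} {t : Y → ℕ} {t₀ : ℕ} (h : Admissible s t t₀)
    {μ : PMF (Multigraph X Y)} (hμ : IsUniformOn μ (stratum s t 0)) (n : ℕ) :
    ∀ (m : Index) (τ : ℕ) (G : Multigraph X Y),
    stateLaw s t t₀ μ n (State.running m τ G) =
      if G ∈ multigraphs s t ∧ m = indexOf G ∧ τ = topIndex (maxDeg s t) m ∧
          numMultiple (maxDeg s t) m = n ∧ totalMult (maxDeg s t) m < t₀ then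
        ENNReal.ofReal (visitProb s t t₀ m)
      else 0 := by
  have ht₀ : 0 < t₀ := by
    have := h.threshold.gt_seven
    omega
  have hzero : totalMult (maxDeg s t) 0 < t₀ := by simpa [totalMult] using ht₀
  have hN : (0 : ℝ) < (stratum s t 0).ncard := Nat.cast_pos.2 hμ.ncard_pos
  have hβ := h.beta_nonneg hzero
  induction n with
  | zero =>
    intro m τ G
    rw [stateLaw, PMF.map_apply]
    by_cases hm : m = 0 ∧ τ = 2
    · obtain ⟨rfl, rfl⟩ := hm
      rw [tsum_eq_single G]
      · rw [if_pos rfl, hμ G]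
        have : G ∈ stratum s t 0 ↔ G ∈ multigraphs s t ∧ 0 = indexOf G ∧
            2 = topIndex (maxDeg s t) 0 ∧ numMultiple (maxDeg s t) 0 = 0 ∧
            totalMult (maxDeg s t) 0 < t₀ := by
          constructor
          · rintro ⟨h1, h2⟩
            refine ⟨h1, ?_, (topIndex_zero _).symm, by simp [numMultiple], hzero⟩
            exact ((numMultiple_indexOf_eq_zero_iff h1).1 (Finset.sum_eq_zero h2)).symm
          · rintro ⟨h1, h2, _⟩
            exact ⟨h1, fun i _ => by rw [← h2]⟩
        simp only [← this]
        split_ifs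
        · rw [visitProb, div_mul_cancel_left₀ (by positivity), ENNReal.ofReal_inv_of_pos hN,
            ENNReal.ofReal_natCast]
        · rfl
      · intro G' hG'
        rw [if_neg]
        rintro ⟨⟩
        exact hG' rfl
    · rw [if_neg, ENNReal.tsum_eq_zero]
      · intro G'
        rw [if_neg]
        rintro ⟨⟩
        exact hm ⟨rfl, rfl⟩
      · rintro ⟨h1, rfl, rfl, h2, _⟩
        rw [(numMultiple_indexOf_eq_zero_iff h1).1 h2, topIndex_zero] at hm
        exact hm ⟨rfl, rfl⟩
  | succ n ih =>
    intro m k H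
    -- By induction the running states of positive mass are determined by their multigraph, so the
    -- sum over states becomes a sum over multigraphs.
    let φ : Multigraph X Y → State X Y := fun G =>
      State.running (indexOf G) (topIndex (maxDeg s t) (indexOf G)) G
    have hφ : Function.Injective φ := fun G G' hG => (State.running.inj hG).2.2
    have hsum : stateLaw s t t₀ μ (n + 1) (State.running m k H) =
        ∑' G, stateLaw s t t₀ μ n (φ G) * step s t t₀ (φ G) (State.running m k H) := by
      rw [stateLaw, PMF.bind_apply]
      refine (hφ.tsum_eq (f := fun b => stateLaw s t t₀ μ n b *
        step s t t₀ b (State.running m k H)) ?_).symm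
      rintro (⟨m', τ, G⟩ | G | _) hb
      · have hb1 := left_ne_zero_of_mul hb
        rw [ih] at hb1
        have hb2 := (ite_ne_right_iff.1 hb1).1
        obtain ⟨_, rfl, rfl, _⟩ := hb2
        exact ⟨G, rfl⟩
      · simp [step] at hb
      · simp [step] at hb
    have hpred : ∀ G, ∀ S ∈ (switchings k G).filter (fun S => perform G S = H),
        k ∈ Finset.Icc (topIndex (maxDeg s t) (indexOf G)) (maxDeg s t) →
        (G ∈ multigraphs s t ↔ H ∈ multigraphs s t) ∧ indexOf H = indexOf G + unitIndex k ∧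
          k = topIndex (maxDeg s t) (indexOf H) ∧ numMultiple (maxDeg s t) (indexOf H) =
            numMultiple (maxDeg s t) (indexOf G) + 1 := by
      intro G S hS hk
      obtain ⟨h1, rfl⟩ := Finset.mem_filter.1 hS
      rw [mem_switchings] at h1
      have h2 := (Finset.mem_Icc.1 (topIndex_mem h.two_le (indexOf G))).1.trans
        (Finset.mem_Icc.1 hk).1
      refine ⟨(perform_mem_multigraphs_iff h1).symm, indexOf_perform h2 h1, ?_, ?_⟩
      · rw [indexOf_perform h2 h1, topIndex_add_unitIndex hk]
      · rw [indexOf_perform h2 h1, numMultiple_add_unitIndex]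
        exact Finset.mem_Icc.2 ⟨h2, (Finset.mem_Icc.1 hk).2⟩
    rw [hsum]
    split_ifs with hc
    · obtain ⟨hH, rfl, rfl, hn, hlt⟩ := hc
      obtain ⟨m₀, hm₀, hk⟩ := exists_eq_add_unitIndex h.two_le (m := indexOf H) (Δ := maxDeg s t) (by omega)
      generalize hkk : topIndex (maxDeg s t) (indexOf H) = k at *
      have hk2 : k ∈ Finset.Icc 2 (maxDeg s t) := hkk ▸ topIndex_mem h.two_le _
      have h2k := (Finset.mem_Icc.1 hk2).1
      have hm₀t : totalMult (maxDeg s t) m₀ < t₀ := by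
        rw [hm₀, totalMult_add_unitIndex hk2] at hlt
        omega
      have hprod : ∃ S : Switching X Y k, Produces S H := by
        refine exists_produces hH h.two_le h2k
          (h.totalMult_add_lt_numEdges (Finset.mem_Icc.1 hk2).2 hlt) ?_
        rw [hm₀]
        simp [unitIndex]
      -- A predecessor of `H` has at least one `k`-switching, so f̄_k ≥ 1; this excludes the
      -- degenerate case β_{m₀} = 0.
      have hf : 0 < fUpper s t k := by
        obtain ⟨S, G, hG, rfl⟩ := hprod
        have h1 := fCount_le ((perform_mem_multigraphs_iff hG).1 hH) k
        have h2 : 0 < fCount k G := Finset.card_pos.2 ⟨S, mem_switchings.2 hG⟩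
        unfold fUpper
        exact_mod_cast h2.trans_le h1
      have hlt' := hlt
      rw [hm₀] at hlt'
      have hb := h.bLower_pos hk2 hlt (by rw [hm₀]; simp [unitIndex])
      have hβ₀ := h.beta_nonneg hm₀t
      have hβ₁ := h.beta_nonneg hlt
      have hmass : 0 ≤ visitProb s t t₀ m₀ := by
        unfold visitProb
        positivity
      have hcp := h.chooseProb_nonneg hm₀t hk2
      have hout : (0 : ℝ) ≤ 1 - 1 / (1 + beta s t t₀ m₀) := by
        have := (h.wellDefined.output_prob _ hm₀t).2.2
        linarith
      -- The weight common to all predecessors and switchings; only 1/b(H,S) varies, and that sums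
      -- to 1.
      let c : ℝ≥0∞ := ENNReal.ofReal (visitProb s t t₀ m₀ * ((1 - 1 / (1 + beta s t t₀ m₀)) *
        (chooseProb s t t₀ m₀ k * (bLower s t t₀ k (indexOf H) / fUpper s t k))))
      have hterm : ∀ G, stateLaw s t t₀ μ n (φ G) *
          step s t t₀ (φ G) (State.running (indexOf H) k H) =
          ∑ S ∈ switchings k G with perform G S = H,
            c * ENNReal.ofReal ((bCount H S : ℝ)⁻¹) := by
        intro G
        rw [ih]
        by_cases hS : ((switchings k G).filter fun S => perform G S = H).Nonempty
        · obtain ⟨S, hS⟩ := hS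
          obtain ⟨h1, h2⟩ := Finset.mem_filter.1 hS
          have h3 : indexOf G = m₀ := by
            have := indexOf_perform h2k (mem_switchings.1 h1)
            rw [h2, hm₀] at this
            exact (add_right_cancel this).symm
          have hk' := hk
          rw [← h3] at hk'
          obtain ⟨h4, h5, h6, h7⟩ := hpred G S hS hk'
          have hG := h4.2 hH
          rw [step_running h hG (by rw [h3]; exact hm₀t), if_pos, if_pos ⟨hk', h5, hlt⟩, h3,
            ← Finset.mul_sum]
          · have h8 : ∀ S : Switching X Y k, ENNReal.ofReal (bLower s t t₀ k (indexOf H) /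
                fUpper s t k * (bCount H S : ℝ)⁻¹) =
                ENNReal.ofReal (bLower s t t₀ k (indexOf H) / fUpper s t k) *
                  ENNReal.ofReal ((bCount H S : ℝ)⁻¹) := fun S =>
              ENNReal.ofReal_mul (by positivity)
            simp only [h8, ← Finset.mul_sum]
            simp only [c]
            rw [ENNReal.ofReal_mul hmass, ENNReal.ofReal_mul hout, ENNReal.ofReal_mul hcp]
            simp only [mul_assoc]
          · exact ⟨hG, rfl, rfl, by omega, by rw [h3]; exact hm₀t⟩
        · rw [Finset.not_nonempty_iff_eq_empty.1 hS, Finset.sum_empty]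
          split_ifs with h1
          · rw [step_running h h1.1 h1.2.2.2.2, Finset.not_nonempty_iff_eq_empty.1 hS]
            simp
          · rw [zero_mul]
      rw [tsum_congr hterm, tsum_sum_switchings h2k, ← Finset.mul_sum,
        ← ENNReal.ofReal_sum_of_nonneg fun _ _ => by positivity, sum_inv_bCount_eq_one hprod,
        ENNReal.ofReal_one, mul_one]
      simp only [c]
      rw [visitProb, visitProb, hm₀, sum_produces_eq h hk2 hlt' hf]
    · rw [ENNReal.tsum_eq_zero]
      intro G
      rw [ih]
      split_ifs with h1
      · rw [step_running h h1.1 h1.2.2.2.2]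
        split_ifs with h2
        · rw [Finset.filter_eq_empty_iff.2, Finset.sum_empty, mul_zero, mul_zero, mul_zero]
          intro S hS hSH
          obtain ⟨h3, h4, h5, h6⟩ := hpred G S (Finset.mem_filter.2 ⟨hS, hSH⟩) h2.1
          have h7 : m = indexOf H := h2.2.1.trans h4.symm
          refine hc ⟨h3.1 h1.1, h7, by rw [h7]; exact h5, ?_, h2.2.2⟩
          rw [h7, h6, h1.2.2.2.1]
        · rw [mul_zero]
      · rw [zero_mul]

-- Only two states lead to `output H`: itself, and the running state of `H`. The latter has mass at
-- a single time, the number of multiple edges of `H`, so the output probability jumps once and then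
-- stays constant.
open Classical in
theorem stateLaw_output {s : X → ℕ} {t : Y → ℕ} {t₀ : ℕ} (h : Admissible s t t₀)
    {μ : PMF (Multigraph X Y)} (hμ : IsUniformOn μ (stratum s t 0))
    {H : Multigraph X Y} (hH : H ∈ multigraphs s t)
    (hlt : totalMult (maxDeg s t) (indexOf H) < t₀) (n : ℕ) :
    stateLaw s t t₀ μ n (State.output H) =
      if numMultiple (maxDeg s t) (indexOf H) < n then
        ENNReal.ofReal (1 / ((1 + beta s t t₀ 0) * ((stratum s t 0).ncard : ℝ)))
      else 0 := by
  induction n with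
  | zero =>
    rw [stateLaw, PMF.map_apply]
    simp
  | succ n ih =>
    have hw := h.wellDefined
    let b₀ : State X Y := State.running (indexOf H) (topIndex (maxDeg s t) (indexOf H)) H
    have hsub : ∀ b ∉ ({State.output H, b₀} : Finset (State X Y)),
        stateLaw s t t₀ μ n b * step s t t₀ b (State.output H) = 0 := by
      rintro (⟨m, τ, G⟩ | G | _) hb
      · by_contra h0
        have h1 := left_ne_zero_of_mul h0
        have h2 := right_ne_zero_of_mul h0
        rw [stateLaw_running h hμ] at h1
        rw [step_output hw] at h2
        obtain ⟨_, rfl, rfl, _⟩ := (ite_ne_right_iff.1 h1).1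
        obtain ⟨_, rfl⟩ := (ite_ne_right_iff.1 h2).1
        exact hb (by simp [b₀])
      · have : H ≠ G := fun hHG => hb (by simp [hHG])
        simp [step, this]
      · simp [step]
    rw [stateLaw, PMF.bind_apply, tsum_eq_sum hsub, Finset.sum_pair (by simp [b₀]), ih,
      stateLaw_running h hμ, step_output hw]
    have hβ := h.beta_nonneg hlt
    have hval : ENNReal.ofReal (visitProb s t t₀ (indexOf H)) *
        ENNReal.ofReal (1 / (1 + beta s t t₀ (indexOf H))) =
        ENNReal.ofReal (1 / ((1 + beta s t t₀ 0) * ((stratum s t 0).ncard : ℝ))) := by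
      rw [← ENNReal.ofReal_mul' (by positivity), visitProb]
      congr 1
      field_simp
    rcases lt_trichotomy (numMultiple (maxDeg s t) (indexOf H)) n with h1 | h1 | h1
    · simp [h1, h1.ne, h1.trans (Nat.lt_succ_self n), step]
    · simp only [h1, hH, hlt, lt_irrefl, if_false, zero_mul, zero_add, and_self, if_true,
        Nat.lt_succ_self, hval]
    · have h2 : ¬ numMultiple (maxDeg s t) (indexOf H) < n + 1 := by omega
      simp [h1.ne', h2, h1.not_gt]

theorem outputProb_eq {s : X → ℕ} {t : Y → ℕ} {t₀ : ℕ} (h : Admissible s t t₀)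
    {μ : PMF (Multigraph X Y)} (hμ : IsUniformOn μ (stratum s t 0))
    {H : Multigraph X Y} (hH : H ∈ multigraphs s t)
    (hlt : totalMult (maxDeg s t) (indexOf H) < t₀) :
    outputProb s t t₀ μ H =
      ENNReal.ofReal (1 / ((1 + beta s t t₀ 0) * ((stratum s t 0).ncard : ℝ))) := by
  simp only [outputProb, stateLaw_output h hμ hH hlt]
  refine le_antisymm (iSup_le fun n => ?_) ?_
  · split_ifs
    · exact le_rfl
    · exact zero_le
  · refine le_trans ?_ (le_iSup _ (numMultiple (maxDeg s t) (indexOf H) + 1))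
    rw [if_pos (Nat.lt_succ_self _)]

end

end BipartiteGen

theorem mainTheorem3 {X Y : Type*} [Fintype X] [Fintype Y] (s : X → ℕ) (t : Y → ℕ)
    (hst : ∑ x, s x = ∑ y, t y) (hΔ : 2 ≤ BipartiteGen.maxDeg s t)
    (t₀ : ℕ) (ht₀ : BipartiteGen.IsThreshold s t t₀)
    (μ : PMF (BipartiteGen.Multigraph X Y))
    (hμ : BipartiteGen.IsUniformOn μ (BipartiteGen.stratum s t 0)) :
    BipartiteGen.WellDefined s t t₀ ∧
    ∀ H ∈ BipartiteGen.multigraphs s t,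
      BipartiteGen.totalMult (BipartiteGen.maxDeg s t) (BipartiteGen.indexOf H) < t₀ →
      BipartiteGen.outputProb s t t₀ μ H =
        ENNReal.ofReal (1 / ((1 + BipartiteGen.beta s t t₀ 0) *
          ((BipartiteGen.stratum s t 0).ncard : ℝ))) := by
  have h : BipartiteGen.Admissible s t t₀ := ⟨hst, hΔ, ht₀⟩
  exact ⟨h.wellDefined, fun H hH hlt => BipartiteGen.outputProb_eq h hμ hH hlt⟩
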